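/- Let $m\ge 1$ be an integer, let $(P,\sigma)$ be a connected $m$-dimensional smooth Riemannian manifold, let $I\subseteq\mathbb R$ be an open interval, and let $h\in C^\infty(P)$ and $\rho\in C^\infty(I)$ be positive functions. Endow $\overline M=I\times P$ with the Lorentzian metric $$\overline g_{(t,x)}=-h(x)^2\,dt^2+\rho(t)^2\,\sigma_x ,$$ time-oriented by $\partial_t$ (a doubly warped product spacetime). For $t\in I$ put $\Sigma_t=\{t\}\times P$, and for $(t,x)\in\overline M$ put $$\mathcal H(t,x)=\frac{\rho'(t)}{\rho(t)\,h(x)},$$ which is the mean curvature of $\Sigma_t$ at $(t,x)$. Assume that $\rho'\ge 0$ on $I$. Let $M$ be a connected noncompact $m$-dimensional smooth manifold and let $\psi:M\to\overline M$ be a smooth spacelike immersion, that is, $g=\psi^*\overline g$ is a Riemannian metric on $M$. Assume that $(M,g)$ is complete. Let $N$ be the future-pointing unit normal of $\psi$, so that $\overline g(N,N)=-1$, $\overline g(N,d\psi(v))=0$ for all $v\in TM$, and $\overline g(N,\partial_t)<0$. Let $\mathrm{II}$ be the second fundamental form of $\psi$, that is, the component of $\overline\nabla_V W$ normal to $\psi$,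 where $\overline\nabla$ is the Levi-Civita connection of $\overline g$. Let $$H=-\overline g(\mathbf H,N),\qquad \mathbf H=\frac1m\sum_{i=1}^m\mathrm{II}(e_i,e_i)\quad\text{for } g\text{-orthonormal bases }(e_i)\text{ of the tangent spaces of }M,$$ be the mean curvature of $\psi$ in the direction of $N$. Let $\tau:M\to I$ be the first component of $\psi$. Let $t_0\in I$. Suppose that $\psi(M)$ lies above the slice $\Sigma_{t_0}$, that is, $\tau\ge t_0$ on $M$, and that it is asymptotic to $\Sigma_{t_0}$ at infinity, that is, $\tau(p)\to t_0$ as $p\to\infty$ in $M$ (for every $\varepsilon>0$ there is a compact set $K\subseteq M$ with $|\tau-t_0|<\varepsilon$ on $M\setminus K$). If $H\ge\mathcal H\circ\psi$ on $M$, then $\psi(M)=\Sigma_{t_0}$. -/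

import Mathlib

open Set Filter Bundle
open scoped Manifold ContDiff Bundle Topology

noncomputable section

/-- The model vector space `ℝᵐ`. -/
abbrev Euc (m : ℕ) : Type := EuclideanSpace ℝ (Fin m)

/-! ### Immersions into a manifold with a field of bilinear forms on its tangent spaces -/

section Immersion

variable {E : Type*} [NormedAddCommGroup E] [NormedSpace ℝ E]
  {HM : Type*} [TopologicalSpace HM] (IM : ModelWithCorners ℝ E HM)
  {M : Type*} [TopologicalSpace M] [ChartedSpace HM M]
  {F : Type*} [NormedAddCommGroup F] [NormedSpace ℝ F]
  {HN : Type*} [TopologicalSpace HN] (J : ModelWithCorners ℝ F HN)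
  {N : Type*} [TopologicalSpace N] [ChartedSpace HN N]

/-- The coefficients `y ↦ g_y(u, v)` of the metric `g` in the preferred chart `φ` at `q`, for
constant coordinate vectors `u, v`: the value at `y` is `g_{φ⁻¹ y}(d(φ⁻¹)_y u, d(φ⁻¹)_y v)`. -/
def metricInChart (g : ∀ q : N, TangentSpace J q → TangentSpace J q → ℝ) (q : N) (u v : F)
    (y : F) : ℝ :=
  g ((extChartAt J q).symm y)
    (mfderiv 𝓘(ℝ, F) J (extChartAt J q).symm y u)
    (mfderiv 𝓘(ℝ, F) J (extChartAt J q).symm y v)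

/-- The Christoffel symbols of the first kind of the Levi-Civita connection `∇` of `g`, at `q`, in
the preferred chart at `q`: this is `g(∇_u v, w)` at `q` for constant coordinate fields `u, v, w`,
that is (Koszul formula) `½ (∂_u g(v, w) + ∂_v g(u, w) - ∂_w g(u, v))`. -/
def christoffelFirst (g : ∀ q : N, TangentSpace J q → TangentSpace J q → ℝ) (q : N)
    (u v w : TangentSpace J q) : ℝ :=
  (fderiv ℝ (metricInChart J g q v w) (extChartAt J q q) u
    + fderiv ℝ (metricInChart J g q u w) (extChartAt J q q) v
    - fderiv ℝ (metricInChart J g q u v) (extChartAt J q q) w) / 2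

/-- The second derivative at `p`, applied to `v` and `w`, of the map `ψ` read in the preferred
charts at `p` and at `ψ p`. -/
def secondDerivInChart (ψ : M → N) (p : M)
    (v w : TangentSpace IM p) : TangentSpace J (ψ p) :=
  fderiv ℝ (fun y : E => fderiv ℝ (writtenInExtChartAt IM J p ψ) y w) (extChartAt IM p p) v

/-- For a vector `n` at `ψ p` orthogonal to the image of `dψ_p`, this is the component
`g(II(v, w), n) = g(∇_V W, n)` of the second fundamental form `II` of the immersion `ψ`, where `∇`
is the Levi-Civita connection of `g`. In coordinates,
`∇_V W = D²ψ(v, w) + Γ(dψ v, dψ w)` modulo vectors tangent to `ψ`. -/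
def secondFundamentalForm (g : ∀ q : N, TangentSpace J q → TangentSpace J q → ℝ)
    (ψ : M → N) (p : M) (n : TangentSpace J (ψ p)) (v w : TangentSpace IM p) : ℝ :=
  g (ψ p) (secondDerivInChart IM J ψ p v w) n
    + christoffelFirst J g (ψ p) (mfderiv IM J ψ p v) (mfderiv IM J ψ p w) n

end Immersion

/-! ### Doubly warped product spacetimes -/

/-- The linear algebra behind the existence and uniqueness of the unit normal. -/
theorem existsUnique_unitNormal_aux {E : Type*} [AddCommGroup E] [Module ℝ E]
    [FiniteDimensional ℝ E] (a : E →ₗ[ℝ] ℝ) (B : E →ₗ[ℝ] E) (s : E →ₗ[ℝ] E →ₗ[ℝ] ℝ)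
    (hs : ∀ v, v ≠ 0 → 0 < s v v) {h r : ℝ} (hh : 0 < h) (hr : 0 < r)
    (hB : ∀ v, v ≠ 0 → 0 < -h ^ 2 * (a v * a v) + r ^ 2 * s (B v) (B v)) :
    ∃! n : ℝ × E, (∀ v, -h ^ 2 * (n.1 * a v) + r ^ 2 * s n.2 (B v) = 0) ∧
      -h ^ 2 * (n.1 * n.1) + r ^ 2 * s n.2 n.2 = -1 ∧ 0 < n.1 := by
  have hh2 : 0 < h ^ 2 := by positivity
  have hr2 : 0 < r ^ 2 := by positivity
  have hBinj : Function.Injective B := by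
    rw [injective_iff_map_eq_zero]
    intro v hv
    by_contra hne
    have h1 := hB v hne
    rw [hv] at h1
    simp only [map_zero, mul_zero, add_zero] at h1
    nlinarith [mul_self_nonneg (a v)]
  have hBsurj : Function.Surjective B := LinearMap.injective_iff_surjective.1 hBinj
  have hsinj : Function.Injective s := by
    rw [injective_iff_map_eq_zero]
    intro v hv
    by_contra hne
    have h1 := hs v hne
    simp [hv] at h1
  have hssurj : Function.Surjective s :=
    (LinearMap.injective_iff_surjective_of_finrank_eq_finrank
      (Subspace.dual_finrank_eq (K := ℝ) (V := E)).symm).1 hsinj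
  let e := LinearEquiv.ofBijective B ⟨hBinj, hBsurj⟩
  obtain ⟨w, hw⟩ := hssurj ((h ^ 2 / r ^ 2) • (a ∘ₗ e.symm.toLinearMap))
  have hw' : ∀ v, r ^ 2 * s w (B v) = h ^ 2 * a v := by
    intro v
    have h1 : e.symm (B v) = v := e.symm_apply_apply v
    rw [hw]
    simp only [LinearMap.smul_apply, LinearMap.comp_apply, LinearEquiv.coe_coe, h1, smul_eq_mul]
    field_simp
  have hneg : -h ^ 2 + r ^ 2 * s w w < 0 := by
    obtain ⟨v, rfl⟩ := hBsurj w
    by_cases hv : v = 0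
    · simp only [hv, map_zero, mul_zero, add_zero]; linarith
    · have h1 := hB v hv
      rw [hw' v] at h1 ⊢
      have h2 : a v < 1 := by
        by_contra hge
        have h3 : a v ≤ a v * a v := le_mul_of_one_le_left (by linarith) (by linarith)
        nlinarith [mul_le_mul_of_nonneg_left h3 hh2.le]
      nlinarith
  set c := Real.sqrt (-(-h ^ 2 + r ^ 2 * s w w)) with hc
  have hcpos : 0 < c := Real.sqrt_pos.2 (by linarith)
  have hc2 : c ^ 2 = -(-h ^ 2 + r ^ 2 * s w w) := Real.sq_sqrt (by linarith)
  refine ⟨(c⁻¹, c⁻¹ • w), ⟨fun v => ?_, ?_, inv_pos.2 hcpos⟩, ?_⟩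
  · have := hw' v
    simp only [map_smul, LinearMap.smul_apply, smul_eq_mul]
    linear_combination c⁻¹ * this
  · simp only [map_smul, LinearMap.smul_apply, smul_eq_mul]
    field_simp
    linarith
  · rintro ⟨t, u⟩ ⟨h1, h2, h3⟩
    simp only at h1 h2 h3
    have hu : u = t • w := by
      apply hsinj
      ext x
      obtain ⟨v, rfl⟩ := hBsurj x
      simp only [map_smul, LinearMap.smul_apply, smul_eq_mul]
      have := h1 v
      have := hw' v
      apply mul_left_cancel₀ hr2.ne'
      linear_combination h1 v - t * hw' v
    subst hu
    simp only [map_smul, LinearMap.smul_apply, smul_eq_mul] at h2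
    have h4 : (t * c) ^ 2 = 1 := by rw [mul_pow, hc2]; linear_combination -h2
    have h5 : t * c = 1 := by
      have : 0 < t * c := by positivity
      nlinarith
    have h6 : t = c⁻¹ := eq_inv_of_mul_eq_one_left h5
    rw [h6]

/-- The data of a doubly warped product spacetime `I _h×_ρ P` over the `m`-dimensional smooth
manifold `P`: an open interval `I`, a smooth positive function `ρ` on `I`, a smooth positive
function `h` on `P` and a smooth Riemannian metric `σ` on `P`. The spacetime is the open subset
`I × P` of the product manifold `ℝ × P`; only the values of `ρ` on `I` matter. -/
structure DoublyWarpedProduct (m : ℕ) (P : Type*) [TopologicalSpace P]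
    [ChartedSpace (Euc m) P] [IsManifold (𝓡 m) ∞ P] where
  /-- the interval `I` -/
  interval : Set ℝ
  isOpen_interval : IsOpen interval
  ordConnected_interval : interval.OrdConnected
  /-- the warping function `ρ` -/
  ρ : ℝ → ℝ
  contDiffOn_ρ : ContDiffOn ℝ ∞ ρ interval
  ρ_pos : ∀ t ∈ interval, 0 < ρ t
  /-- the warping function `h` -/
  h : P → ℝ
  contMDiff_h : ContMDiff (𝓡 m) 𝓘(ℝ, ℝ) ∞ h
  h_pos : ∀ x, 0 < h x
  /-- the Riemannian metric `σ` of `P` -/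
  σ : Bundle.ContMDiffRiemannianMetric (𝓡 m) ∞ (Euc m) (fun x : P => TangentSpace (𝓡 m) x)

/-- The model with corners of `ℝ × P`, for `P` an `m`-dimensional manifold. -/
abbrev prodModel (m : ℕ) : ModelWithCorners ℝ (ℝ × Euc m) (ModelProd ℝ (Euc m)) :=
  𝓘(ℝ, ℝ).prod (𝓡 m)

namespace DoublyWarpedProduct

variable {m : ℕ} {P : Type*} [TopologicalSpace P] [ChartedSpace (Euc m) P]
  [IsManifold (𝓡 m) ∞ P] (D : DoublyWarpedProduct m P)

/-- The Lorentzian metric `-h(x)² dt² + ρ(t)² σ` at `q = (t, x)`. -/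
def metric (q : ℝ × P) (u v : TangentSpace (prodModel m) q) : ℝ :=
  -(D.h q.2) ^ 2 * (u.1 * v.1) + (D.ρ q.1) ^ 2 * D.σ.inner q.2 u.2 v.2

/-- The vector field `∂_t`, which defines the time orientation. -/
def timeField (q : ℝ × P) : TangentSpace (prodModel m) q := ((1, 0) : ℝ × Euc m)

/-- The slice `Σ_t = {t} × P`. -/
def slice (_D : DoublyWarpedProduct m P) (t : ℝ) : Set (ℝ × P) := {t} ×ˢ univ

/-- The function `ℋ(t, x) = ρ'(t) / (ρ(t) h(x))`, the mean curvature of `Σ_t` at `(t, x)`. -/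
def sliceMeanCurvature (q : ℝ × P) : ℝ := deriv D.ρ q.1 / (D.ρ q.1 * D.h q.2)

section Hypersurface

variable {M : Type*} [TopologicalSpace M] [ChartedSpace (Euc m) M]

instance instFiniteDimensionalTangentSpace (p : M) :
    FiniteDimensional ℝ (TangentSpace (𝓡 m) p) :=
  inferInstanceAs (FiniteDimensional ℝ (Euc m))

/-- `n` is the future-pointing unit normal at `p` of the map `ψ` into `D`: it is orthogonal to the
image of `dψ_p`, it has square `-1`, and `g(n, ∂_t) < 0`. -/
structure IsFutureUnitNormal (ψ : M → ℝ × P) (p : M)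
    (n : TangentSpace (prodModel m) (ψ p)) : Prop where
  orthogonal : ∀ v : TangentSpace (𝓡 m) p,
    D.metric (ψ p) n (mfderiv (𝓡 m) (prodModel m) ψ p v) = 0
  unit : D.metric (ψ p) n n = -1
  future : D.metric (ψ p) n (timeField (ψ p)) < 0

/-- The future-pointing unit normal; see `existsUnique_isFutureUnitNormal`. -/
def futureUnitNormal (ψ : M → ℝ × P) (p : M) : TangentSpace (prodModel m) (ψ p) :=
  Classical.epsilon (D.IsFutureUnitNormal ψ p)

/-- `ψ` is a spacelike immersion into `I × P`, and the Riemannian metric `g` of `M` is the induced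
one: `ψ` is smooth, takes values in `I × P`, and `g` is the pullback of the Lorentzian metric. (As
`g` is positive definite, `dψ_p` is injective at every `p`.) -/
structure IsSpacelikeImmersion [RiemannianBundle (fun p : M => TangentSpace (𝓡 m) p)]
    (ψ : M → ℝ × P) : Prop where
  contMDiff : ContMDiff (𝓡 m) (prodModel m) ∞ ψ
  mem_interval : ∀ p, (ψ p).1 ∈ D.interval
  isometric : ∀ (p : M) (v w : TangentSpace (𝓡 m) p),
    inner ℝ v w = D.metric (ψ p) (mfderiv (𝓡 m) (prodModel m) ψ p v)
      (mfderiv (𝓡 m) (prodModel m) ψ p w)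

/-- At every point, a spacelike immersion has exactly one future-pointing unit normal. -/
theorem existsUnique_isFutureUnitNormal
    [RiemannianBundle (fun p : M => TangentSpace (𝓡 m) p)]
    {ψ : M → ℝ × P} (hψ : D.IsSpacelikeImmersion ψ) (p : M) :
    ∃! n, D.IsFutureUnitNormal ψ p n := by
  let A : Euc m →L[ℝ] ℝ × Euc m := mfderiv (𝓡 m) (prodModel m) ψ p
  let s : Euc m →L[ℝ] Euc m →L[ℝ] ℝ := D.σ.inner (ψ p).2
  have key := existsUnique_unitNormal_aux
    (a := LinearMap.fst ℝ ℝ (Euc m) ∘ₗ A.toLinearMap)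
    (B := LinearMap.snd ℝ ℝ (Euc m) ∘ₗ A.toLinearMap)
    (s := (ContinuousLinearMap.coeLM ℝ) ∘ₗ s.toLinearMap)
    (hs := fun v hv => D.σ.pos (ψ p).2 v hv)
    (hh := D.h_pos (ψ p).2) (hr := D.ρ_pos _ (hψ.mem_interval p))
    (hB := fun v hv => by
      have h1 := hψ.isometric p v v
      let v' : TangentSpace (𝓡 m) p := v
      have h2 : 0 < inner ℝ v' v' := real_inner_self_pos.2 hv
      exact h2.trans_eq h1)
  refine (existsUnique_congr fun n => ?_).1 key
  constructor
  · rintro ⟨h1, h2, h3⟩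
    refine ⟨h1, h2, ?_⟩
    change -(D.h (ψ p).2) ^ 2 * (n.1 * 1) + (D.ρ (ψ p).1) ^ 2 * s n.2 0 < 0
    have := D.h_pos (ψ p).2
    rw [map_zero]
    nlinarith [mul_pos (pow_pos this 2) h3]
  · rintro ⟨h1, h2, h3⟩
    refine ⟨h1, h2, ?_⟩
    change -(D.h (ψ p).2) ^ 2 * (n.1 * 1) + (D.ρ (ψ p).1) ^ 2 * s n.2 0 < 0 at h3
    have := D.h_pos (ψ p).2
    rw [map_zero] at h3
    by_contra hn
    nlinarith [mul_nonneg (pow_pos this 2).le (neg_nonneg.2 (not_lt.1 hn))]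

/-- The future-pointing unit normal of a spacelike immersion has its defining properties. -/
theorem isFutureUnitNormal_futureUnitNormal
    [RiemannianBundle (fun p : M => TangentSpace (𝓡 m) p)]
    {ψ : M → ℝ × P} (hψ : D.IsSpacelikeImmersion ψ) (p : M) :
    D.IsFutureUnitNormal ψ p (D.futureUnitNormal ψ p) :=
  Classical.epsilon_spec (D.existsUnique_isFutureUnitNormal hψ p).exists

/-- The mean curvature `H = -g(𝐇, N)` at `p` of the spacelike immersion `ψ` in the direction of the
future-pointing unit normal `N`, where `𝐇 = (1/m) ∑ᵢ II(eᵢ, eᵢ)` for an orthonormal basis `(eᵢ)`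
of the tangent space of `M` at `p`. -/
def meanCurvature [RiemannianBundle (fun p : M => TangentSpace (𝓡 m) p)]
    (ψ : M → ℝ × P) (p : M) : ℝ :=
  -((1 / (m : ℝ)) * ∑ i, secondFundamentalForm (𝓡 m) (prodModel m) D.metric ψ p
      (D.futureUnitNormal ψ p)
      (stdOrthonormalBasis ℝ (TangentSpace (𝓡 m) p) i)
      (stdOrthonormalBasis ℝ (TangentSpace (𝓡 m) p) i))

end Hypersurface

end DoublyWarpedProduct

end

open Set Filter Bundle
open scoped Manifold ContDiff Bundle Topology

noncomputable section

set_option synthInstance.maxHeartbeats 200000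

/-! Let `τ` be the time component of `ψ`, and write `η = h ∘ ψ`. Split the future normal into
tangential and vertical parts: `N = c η² ∇τ + c ∂_t`, where `c η = (1 + η² |∇τ|²)^(-1/2) ≤ 1`. The
tangential part of `N` turns the second fundamental form into Christoffel symbols of the induced
metric, and the `∂_t` part is explicit for a warped metric. Summing over an orthonormal frame
expresses `-m H` as `-c η² X - m c ρ'/ρ`, where `X = Δτ + (2/η) ⟨∇η, ∇τ⟩ + (ρ'/ρ) |∇τ|²`. The
hypothesis `H ≥ ρ'/(ρ η)` then gives `c η² X ≥ m (ρ'/ρ) (1/η - c) ≥ 0`; the last sign uses `ρ' ≥ 0`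
and `c ≤ 1/η`. This is `warped_time_subsolution`, transferred to the manifold by
`exists_isTimeSubsolutionAt`.

If `τ > t₀` somewhere, then `τ` attains its maximum, because it tends to `t₀` at infinity. In a
chart the inequality `X ≥ 0` is locally uniformly elliptic, the quadratic gradient term being a
bounded multiple of the gradient, so Hopf's strong maximum principle makes the set of maximum points
open. It is also closed, so `τ` is constant by connectedness. Since `M` is not compact, the constant
must be the limit `t₀`, a contradiction. Hence `τ = t₀` everywhere.

The component `M → P` is then a local homothety of ratio `ρ(t₀)²`. By `surjective_of_homothety` it
is onto: near a point of `P`, preimages can be moved towards any nearby target at a cost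
proportional to the progress made, and completeness of `M`, through a Caristi argument
(`exists_eq_zero_of_decrease`), makes the motion arrive. Thus the range is open and closed in the
connected manifold `P`. -/

/-! ### Hopf's strong maximum principle in a Euclidean space. -/

theorem IsLocalMax.fderiv_fderiv_apply_self_nonpos {E : Type*} [NormedAddCommGroup E]
    [NormedSpace ℝ E] {f : E → ℝ} {x : E} (hmax : IsLocalMax f x) (hf : ContDiffAt ℝ 2 f x) (v : E) :
    fderiv ℝ (fun y => fderiv ℝ f y v) x v ≤ 0 := by
  by_contra! hpos
  set l : ℝ → E := fun t => x + t • v with hl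
  have hlc : Continuous l := by fun_prop
  have hl0 : l 0 = x := by simp [hl]
  have hld : ∀ t, HasDerivAt l v t := fun t => by
    simpa [hl] using ((hasDerivAt_id t).smul_const v).const_add x
  have htend : Tendsto l (𝓝 0) (𝓝 x) := by
    have := hlc.tendsto 0; rwa [hl0] at this
  have hev : ∀ᶠ y in 𝓝 x, DifferentiableAt ℝ f y := by
    filter_upwards [hf.eventually (by simp)] with y hy
    exact hy.differentiableAt (by simp)
  have hderiv : deriv (f ∘ l) =ᶠ[𝓝 0] fun t => fderiv ℝ f (l t) v := by
    filter_upwards [htend.eventually hev] with t ht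
    exact (ht.hasFDerivAt.comp_hasDerivAt t (hld t)).deriv
  have hD : DifferentiableAt ℝ (fun y => fderiv ℝ f y v) x := by
    have : DifferentiableAt ℝ (fderiv ℝ f) x :=
      (hf.fderiv_right (m := 1) (by norm_num)).differentiableAt (by simp)
    exact this.clm_apply (differentiableAt_const _)
  have h2 : deriv (deriv (f ∘ l)) 0 = fderiv ℝ (fun y => fderiv ℝ f y v) x v := by
    rw [hderiv.deriv_eq]
    have hD' := hD.hasFDerivAt
    rw [← hl0] at hD'
    have := (hD'.comp_hasDerivAt 0 (hld 0)).deriv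
    rw [hl0] at this
    exact this
  have h1 : deriv (f ∘ l) 0 = 0 := by
    rw [hderiv.eq_of_nhds, hl0, hmax.fderiv_eq_zero]; rfl
  have hcont : ContinuousAt (f ∘ l) 0 :=
    ContinuousAt.comp (by rw [hl0]; exact hf.continuousAt) hlc.continuousAt
  -- A positive second derivative along the line makes `0` a local minimum as well as a local
  -- maximum, so the restriction is locally constant and its second derivative is `0`.
  have hmin : IsLocalMin (f ∘ l) 0 :=
    isLocalMin_of_deriv_deriv_pos (by rw [h2]; exact hpos) h1 hcont
  have hmax' : ∀ᶠ t in 𝓝 (0 : ℝ), (f ∘ l) t ≤ (f ∘ l) 0 := by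
    filter_upwards [htend.eventually hmax] with t ht
    simpa [hl0] using ht
  have hconst : (f ∘ l) =ᶠ[𝓝 0] fun _ => (f ∘ l) 0 := by
    filter_upwards [hmax', hmin] with t h h' using le_antisymm h h'
  have h3 : deriv (deriv (f ∘ l)) 0 = 0 := by
    rw [hconst.deriv.deriv_eq]; simp
  linarith

section Barrier

variable {E : Type*} [NormedAddCommGroup E] [InnerProductSpace ℝ E]

/-- The Gaussian barrier function of the Hopf maximum principle. -/
def gaussianBarrier (α : ℝ) (c z : E) : ℝ := Real.exp (-α * ‖z - c‖ ^ 2)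

theorem contDiff_gaussianBarrier (α : ℝ) (c : E) : ContDiff ℝ ∞ (gaussianBarrier α c) := by
  unfold gaussianBarrier
  exact Real.contDiff_exp.comp (contDiff_const.mul ((contDiff_id.sub contDiff_const).norm_sq ℝ))

theorem hasFDerivAt_gaussianBarrier (α : ℝ) (c z : E) :
    HasFDerivAt (gaussianBarrier α c)
      ((-2 * α * gaussianBarrier α c z) • innerSL ℝ (z - c)) z := by
  have h1 : HasFDerivAt (fun z : E => ‖z - c‖ ^ 2) (2 • innerSL ℝ (z - c)) z := by
    have := ((hasFDerivAt_id z).sub_const c).norm_sq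
    simpa using this
  have h2 := (h1.const_mul (-α)).exp
  refine h2.congr_fderiv ?_
  ext a
  simp [gaussianBarrier]
  ring

theorem fderiv_fderiv_gaussianBarrier (α : ℝ) (c z a : E) :
    fderiv ℝ (fun y => fderiv ℝ (gaussianBarrier α c) y a) z a =
      gaussianBarrier α c z * (4 * α ^ 2 * inner ℝ (z - c) a ^ 2 - 2 * α * ‖a‖ ^ 2) := by
  have h1 : (fun y => fderiv ℝ (gaussianBarrier α c) y a) =
      fun y => (-2 * α) * gaussianBarrier α c y * inner ℝ (y - c) a := by
    ext y
    rw [(hasFDerivAt_gaussianBarrier α c y).fderiv]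
    simp only [smul_apply, innerSL_apply_apply, smul_eq_mul]
  have h2 : HasFDerivAt (fun y => inner ℝ (y - c) a) (innerSL ℝ a) z := by
    have := (innerSL ℝ a).hasFDerivAt (x := z - c)
    have := this.comp z ((hasFDerivAt_id z).sub_const c)
    refine (this.congr_of_eventuallyEq (Eventually.of_forall fun y => ?_)).congr_fderiv ?_
    · simp [real_inner_comm]
    · ext; simp
  have h3 := ((hasFDerivAt_gaussianBarrier α c z).const_mul (-2 * α)).mul h2
  rw [h1]
  erw [h3.fderiv]
  simp only [add_apply, smul_apply, innerSL_apply_apply,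
    smul_eq_mul, real_inner_self_eq_norm_sq]
  ring

end Barrier

/-- A pointwise form of uniform ellipticity on `U`: at every point of `U` there is a finite family of
vectors along which the second derivatives of `u` sum to at least `-C ‖Du‖`. -/
def IsEllipticSubsolutionOn (ι : Type*) [Fintype ι] {E : Type*} [NormedAddCommGroup E]
    [InnerProductSpace ℝ E] (u : E → ℝ) (U : Set E) (lam Lam C : ℝ) : Prop :=
  ∀ y ∈ U, ∃ a : ι → E, (∀ i, ‖a i‖ ≤ Lam) ∧ (∀ w, lam * ‖w‖ ^ 2 ≤ ∑ i, inner ℝ w (a i) ^ 2) ∧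
    -C * ‖fderiv ℝ u y‖ ≤ ∑ i, fderiv ℝ (fun z => fderiv ℝ u z (a i)) y (a i)

section MaximumPrinciple

variable {ι : Type*} [Fintype ι] {E : Type*} [NormedAddCommGroup E] [InnerProductSpace ℝ E]
  {u : E → ℝ} {U : Set E} {lam Lam C : ℝ}

/-- A subsolution perturbed by the barrier has no local maximum away from the center. -/
theorem IsEllipticSubsolutionOn.not_isLocalMax_add_barrier
    (hsub : IsEllipticSubsolutionOn ι u U lam Lam C) {z c : E} (hzU : z ∈ U)
    (hu : ContDiffAt ℝ 2 u z) {α ε : ℝ} (hα : 0 < α) (hε : 0 < ε) (hC : 0 ≤ C)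
    (hbig : Fintype.card ι * Lam ^ 2 + C * ‖z - c‖ < 2 * α * lam * ‖z - c‖ ^ 2) :
    ¬ IsLocalMax (fun y => u y + ε * gaussianBarrier α c y) z := by
  intro hmax
  obtain ⟨a, ha, hlam, hL⟩ := hsub z hzU
  set w := gaussianBarrier α c with hw
  have hwpos : 0 < w z := Real.exp_pos _
  have hwd : ContDiff ℝ 2 w := (contDiff_gaussianBarrier α c).of_le (by norm_cast)
  have hεw : ContDiff ℝ 2 (fun y => ε * w y) := contDiff_const.mul hwd
  have hv2 : ∀ i, fderiv ℝ (fun y => fderiv ℝ u y (a i)) z (a i) ≤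
      - (ε * (w z * (4 * α ^ 2 * inner ℝ (z - c) (a i) ^ 2 - 2 * α * ‖a i‖ ^ 2))) := by
    intro i
    have h := hmax.fderiv_fderiv_apply_self_nonpos (hu.add hεw.contDiffAt) (a i)
    have hev : (fun y => fderiv ℝ (fun y => u y + ε * w y) y (a i)) =ᶠ[𝓝 z]
        fun y => fderiv ℝ u y (a i) + ε * fderiv ℝ w y (a i) := by
      filter_upwards [hu.eventually (by simp)] with y hy
      have h1 : HasFDerivAt (fun y => u y + ε * w y) _ y :=
        (hy.differentiableAt (by simp)).hasFDerivAt.add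
          ((hwd.differentiable (by simp) y).hasFDerivAt.const_mul ε)
      rw [h1.fderiv]; simp
    rw [hev.fderiv_eq] at h
    have hd1 : DifferentiableAt ℝ (fun y => fderiv ℝ u y (a i)) z :=
      ((hu.fderiv_right (m := 1) (by norm_num)).differentiableAt (by simp)).clm_apply
        (differentiableAt_const _)
    have hd2 : DifferentiableAt ℝ (fun y => fderiv ℝ w y (a i)) z :=
      ((hwd.contDiffAt.fderiv_right (m := 1) (by norm_num)).differentiableAt (by simp)).clm_apply
        (differentiableAt_const _)
    have h1 := (hd1.hasFDerivAt.add (hd2.hasFDerivAt.const_mul ε)).fderiv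
    have h2 : fderiv ℝ (fun y => fderiv ℝ u y (a i) + ε * fderiv ℝ w y (a i)) z (a i) =
        fderiv ℝ (fun y => fderiv ℝ u y (a i)) z (a i)
          + ε * fderiv ℝ (fun y => fderiv ℝ w y (a i)) z (a i) := by
      erw [h1]; simp
    rw [h2, hw, fderiv_fderiv_gaussianBarrier] at h
    linarith
  -- At a critical point `Du = -ε Dw`, so the first order term is controlled by the barrier itself.
  have hDu : ‖fderiv ℝ u z‖ ≤ ε * (2 * α * w z * ‖z - c‖) := by
    have h0 := hmax.fderiv_eq_zero
    have h1 : HasFDerivAt (fun y => u y + ε * w y) _ z :=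
      (hu.differentiableAt (by simp)).hasFDerivAt.add
        ((hasFDerivAt_gaussianBarrier α c z).const_mul ε)
    rw [h1.fderiv] at h0
    rw [eq_neg_of_add_eq_zero_left h0, norm_neg, norm_smul, norm_smul, innerSL_apply_norm,
      Real.norm_of_nonneg hε.le, Real.norm_eq_abs, abs_mul, abs_mul, abs_of_pos hα,
      abs_of_pos hwpos]
    norm_num
  -- The common factor `ε w 2α` cancels from both sides, leaving `2α ∑ ⟨z - c, aᵢ⟩² ≤ ∑ ‖aᵢ‖² + C ‖z
  -- - c‖`, which `hbig` and ellipticity forbid.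
  have hsum := hL.trans (Finset.sum_le_sum fun i _ => hv2 i)
  have hsum2 : ∑ i, -(ε * (w z * (4 * α ^ 2 * inner ℝ (z - c) (a i) ^ 2 - 2 * α * ‖a i‖ ^ 2))) =
      -(ε * w z * (2 * α) * (2 * α * ∑ i, inner ℝ (z - c) (a i) ^ 2 - ∑ i, ‖a i‖ ^ 2)) := by
    simp only [Finset.mul_sum, ← Finset.sum_sub_distrib, ← Finset.sum_neg_distrib]
    exact Finset.sum_congr rfl fun i _ => by ring
  have hcard : ∑ i, ‖a i‖ ^ 2 ≤ Fintype.card ι * Lam ^ 2 := by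
    calc ∑ i, ‖a i‖ ^ 2 ≤ ∑ _i : ι, Lam ^ 2 :=
          Finset.sum_le_sum fun i _ => pow_le_pow_left₀ (norm_nonneg _) (ha i) 2
      _ = _ := by simp
  rw [hsum2] at hsum
  have hk : 0 < ε * w z * (2 * α) := by positivity
  have h5 : C * ‖fderiv ℝ u z‖ ≤ ε * w z * (2 * α) * (C * ‖z - c‖) := by
    calc C * ‖fderiv ℝ u z‖ ≤ C * (ε * (2 * α * w z * ‖z - c‖)) :=
          mul_le_mul_of_nonneg_left hDu hC
      _ = _ := by ring
  have h6 : ε * w z * (2 * α) * (2 * α * ∑ i, inner ℝ (z - c) (a i) ^ 2 - ∑ i, ‖a i‖ ^ 2)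
      ≤ ε * w z * (2 * α) * (C * ‖z - c‖) := by linarith
  have h7 := le_of_mul_le_mul_left h6 hk
  have h8 := mul_le_mul_of_nonneg_left (hlam (z - c)) (by positivity : (0 : ℝ) ≤ 2 * α)
  linarith

/-- If `u` attains its maximum over `U` at a point of a closed ball contained in `U`, then it attains
it at an interior point of the ball or at no single boundary point. -/
theorem IsEllipticSubsolutionOn.false_of_unique_contact [FiniteDimensional ℝ E]
    (hsub : IsEllipticSubsolutionOn ι u U lam Lam C) (hU : IsOpen U) (hu : ContDiffOn ℝ 2 u U)
    (hlam : 0 < lam) (hC : 0 ≤ C) {y₂ c : E} {R : ℝ} (hR : 0 < R)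
    (hy₂ : ‖y₂ - c‖ = R) (hK : Metric.closedBall y₂ (R / 2) ⊆ U) (hmax : ∀ y ∈ U, u y ≤ u y₂)
    (hlt : ∀ y ∈ Metric.closedBall c R, y ∈ U → y ≠ y₂ → u y < u y₂) : False := by
  set K := Metric.closedBall y₂ (R / 2)
  have hKc : IsCompact K := isCompact_closedBall _ _
  have hy₂K : y₂ ∈ K := Metric.mem_closedBall_self (by positivity)
  set T := Metric.sphere y₂ (R / 2) ∩ Metric.closedBall c R
  have hTK : T ⊆ K := fun z hz => Metric.sphere_subset_closedBall hz.1
  have hTc : IsCompact T := (isCompact_sphere _ _).inter_right Metric.isClosed_closedBall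
  -- On the part of the small sphere inside the touching ball, compactness turns strict inequality
  -- into a gap `δ`; the barrier, being at most `1`, is added with weight `δ / 2` so as not to close
  -- the gap.
  have hδ : ∃ δ > 0, ∀ z ∈ T, u z ≤ u y₂ - δ := by
    rcases T.eq_empty_or_nonempty with hT | hT
    · exact ⟨1, one_pos, by simp [hT]⟩
    · obtain ⟨z, hz, hzmax⟩ := hTc.exists_isMaxOn hT
        (hu.continuousOn.mono (hTK.trans hK))
      refine ⟨u y₂ - u z, sub_pos.2 (hlt z hz.2 (hK (hTK hz)) ?_), fun y hy => ?_⟩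
      · rintro rfl
        have := hz.1
        simp only [Metric.mem_sphere, dist_self] at this
        linarith
      · have := hzmax hy
        simp only [mem_ofPred_eq] at this
        linarith
  obtain ⟨δ, hδpos, hδ⟩ := hδ
  set A : ℝ := Fintype.card ι * Lam ^ 2 + C * (2 * R) + 1 with hA
  have hApos : 0 < A := by positivity
  -- Chosen so that `2 α lam (R/2)² = A`. On the small ball `R/2 ≤ ‖z - c‖ ≤ 2R`, and `A` exceeds
  -- the terms to be dominated by `1`.
  set α : ℝ := 2 * A / (lam * R ^ 2) with hα
  have hαpos : 0 < α := by positivity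
  set w := gaussianBarrier α c with hw
  set v : E → ℝ := fun y => u y + δ / 2 * w y with hv
  have hwc : Continuous w := (contDiff_gaussianBarrier α c).continuous
  obtain ⟨z, hzK, hzmax⟩ := hKc.exists_isMaxOn ⟨y₂, hy₂K⟩
    (f := v) ((hu.continuousOn.mono hK).add (hwc.const_smul (δ / 2)).continuousOn)
  have hle := hzmax hy₂K
  simp only [mem_ofPred_eq, hv] at hle
  have hw1 : ∀ y, w y ≤ 1 := fun y => Real.exp_le_one_iff.2 (by
    have := mul_nonneg hαpos.le (sq_nonneg ‖y - c‖); linarith)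
  have hwy₂ : 0 < w y₂ := Real.exp_pos _
  -- On the sphere `v < v y₂`: inside the touching ball by the gap `δ`, outside it because the
  -- barrier decreases with the distance from `c` and `u ≤ u y₂`.
  have hzint : z ∈ Metric.ball y₂ (R / 2) := by
    by_contra hznot
    have hzs : z ∈ Metric.sphere y₂ (R / 2) :=
      le_antisymm hzK (not_lt.1 hznot)
    by_cases hzc : z ∈ Metric.closedBall c R
    · have h1 := hδ z ⟨hzs, hzc⟩
      have h2 := mul_le_mul_of_nonneg_left (hw1 z) (by positivity : 0 ≤ δ / 2)
      have h3 : 0 < δ / 2 * w y₂ := by positivity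
      linarith
    · have h1 := hmax z (hK hzK)
      have h2 : w z < w y₂ := by
        refine Real.exp_lt_exp.2 ?_
        have h4 : R < ‖z - c‖ := by
          rw [Metric.mem_closedBall, dist_eq_norm] at hzc; linarith
        have h3 : ‖y₂ - c‖ ^ 2 < ‖z - c‖ ^ 2 := by
          rw [hy₂]; exact pow_lt_pow_left₀ h4 hR.le two_ne_zero
        have := mul_lt_mul_of_pos_left h3 hαpos
        linarith
      have h3 := mul_lt_mul_of_pos_left h2 (by positivity : 0 < δ / 2)
      linarith
  have hloc : IsLocalMax v z :=
    hzmax.isLocalMax (mem_of_superset (Metric.isOpen_ball.mem_nhds hzint)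
      Metric.ball_subset_closedBall)
  have hd1 : ‖z - y₂‖ ≤ R / 2 := by rwa [← dist_eq_norm]
  have hlow : R / 2 ≤ ‖z - c‖ := by
    have := norm_sub_norm_le (y₂ - c) (y₂ - z)
    rw [show y₂ - c - (y₂ - z) = z - c by abel, hy₂, norm_sub_rev y₂ z] at this
    linarith
  have hup : ‖z - c‖ ≤ 2 * R := by
    have := norm_add_le (z - y₂) (y₂ - c)
    rw [sub_add_sub_cancel, hy₂] at this
    linarith
  refine hsub.not_isLocalMax_add_barrier (hK hzK)
    (hu.contDiffAt (hU.mem_nhds (hK hzK))) hαpos (half_pos hδpos) hC ?_ hloc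
  have h1 : (R / 2) ^ 2 ≤ ‖z - c‖ ^ 2 := pow_le_pow_left₀ (by positivity) hlow 2
  have h2 : 2 * α * lam * (R / 2) ^ 2 = A := by
    rw [hα]; field_simp
  have h3 := mul_le_mul_of_nonneg_left h1 (by positivity : 0 ≤ 2 * α * lam)
  have h4 := mul_le_mul_of_nonneg_left hup hC
  linarith

/-- The strong maximum principle of Hopf. -/
theorem IsEllipticSubsolutionOn.eventually_eq_of_isMax [FiniteDimensional ℝ E]
    (hsub : IsEllipticSubsolutionOn ι u U lam Lam C) (hU : IsOpen U) (hu : ContDiffOn ℝ 2 u U)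
    (hlam : 0 < lam) (hC : 0 ≤ C) {y₀ : E} (hy₀ : y₀ ∈ U) (hmax : ∀ y ∈ U, u y ≤ u y₀) :
    ∀ᶠ y in 𝓝 y₀, u y = u y₀ := by
  obtain ⟨s, hs, hsU⟩ := Metric.isOpen_iff.1 hU y₀ hy₀
  set r := s / 4 with hr
  have hrpos : 0 < r := by positivity
  refine Metric.eventually_nhds_iff_ball.2 ⟨r, hrpos, fun y₁ hy₁ => ?_⟩
  by_contra hne
  have hy₁r : dist y₁ y₀ < r := hy₁
  set S := Metric.closedBall y₀ (2 * r) ∩ {z | u z = u y₀} with hS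
  have hBU : Metric.closedBall y₀ (2 * r) ⊆ U :=
    (Metric.closedBall_subset_ball (by linarith)).trans hsU
  have hSc : IsCompact S := by
    have : IsClosed S := by
      rw [hS]
      exact (hu.continuousOn.mono hBU).preimage_isClosed_of_isClosed Metric.isClosed_closedBall
        (isClosed_singleton (x := u y₀))
    exact (isCompact_closedBall y₀ (2 * r)).of_isClosed_subset this inter_subset_left
  have hy₀S : y₀ ∈ S := ⟨Metric.mem_closedBall_self (by positivity), rfl⟩
  -- The nearest contact point `y₂` to `y₁` leaves the open ball of radius `R` about `y₁` free of
  -- contact points.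
  obtain ⟨y₂, hy₂S, hy₂⟩ := hSc.exists_infDist_eq_dist ⟨y₀, hy₀S⟩ y₁
  set R := dist y₁ y₂ with hR
  have hRle : R < r := by
    rw [← hy₂]; exact (Metric.infDist_le_dist_of_mem hy₀S).trans_lt hy₁r
  have hRpos : 0 < R := by
    refine dist_pos.2 ?_
    rintro rfl
    exact hne hy₂S.2
  have hy₂u : u y₂ = u y₀ := hy₂S.2
  have hinside : ∀ z, dist y₁ z < R → u z < u y₂ := by
    intro z hz
    have hzB : z ∈ Metric.closedBall y₀ (2 * r) := by
      have := dist_triangle z y₁ y₀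
      rw [dist_comm z y₁] at this
      rw [Metric.mem_closedBall]; linarith
    refine lt_of_le_of_ne (hy₂u ▸ hmax z (hBU hzB)) fun heq => ?_
    have : z ∈ S := ⟨hzB, heq.trans hy₂u⟩
    have := Metric.infDist_le_dist_of_mem (x := y₁) this
    linarith
  -- The ball with diameter `y₁ y₂` is internally tangent at `y₂` to the contact-free ball, so `y₂`
  -- is its only contact point.
  set c := midpoint ℝ y₁ y₂ with hc
  have hcy₂ : ‖y₂ - c‖ = R / 2 := by
    rw [← dist_eq_norm, hc, dist_right_midpoint (𝕜 := ℝ) y₁ y₂, Real.norm_two, inv_mul_eq_div]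
  have hcy₁ : y₁ - c = -(y₂ - c) := by
    rw [hc, midpoint_eq_smul_add, invOf_eq_inv]; module
  have hy₂y₀ : dist y₂ y₀ < 2 * r := by
    have := dist_triangle y₂ y₁ y₀
    rw [dist_comm y₂ y₁] at this
    linarith
  refine hsub.false_of_unique_contact hU hu hlam hC (half_pos hRpos) hcy₂ ?_
    (fun y hy => hy₂u ▸ hmax y hy) ?_
  · intro z hz
    refine hsU ?_
    have := dist_triangle z y₂ y₀
    rw [Metric.mem_closedBall] at hz
    rw [Metric.mem_ball]; linarith
  · intro z hz _ hzne
    refine hinside z ?_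
    have hz' : ‖z - c‖ ≤ R / 2 := by simpa [dist_eq_norm] using hz
    -- This reads `‖z - y₂‖² + ‖z - y₁‖² = 2 (‖z - c‖² + R²/4) ≤ R²`, so `‖z - y₁‖ < R` unless `z =
    -- y₂`.
    have hpar := parallelogram_law_with_norm ℝ (z - c) (y₂ - c)
    rw [sub_sub_sub_cancel_right, ← sub_neg_eq_add (z - c), ← hcy₁, sub_sub_sub_cancel_right,
      hcy₂] at hpar
    have hpos : 0 < ‖z - y₂‖ := norm_pos_iff.2 (sub_ne_zero.2 hzne)
    rw [dist_comm, dist_eq_norm]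
    have : ‖z - c‖ * ‖z - c‖ ≤ R / 2 * (R / 2) := mul_self_le_mul_self (norm_nonneg _) hz'
    have hp2 := mul_pos hpos hpos
    nlinarith [norm_nonneg (z - y₁)]

end MaximumPrinciple

/-! ### Christoffel symbols of a field of bilinear forms on a vector space. -/

section FlatChristoffel

variable {E : Type*} [NormedAddCommGroup E] [NormedSpace ℝ E]
  {F : Type*} [NormedAddCommGroup F] [NormedSpace ℝ F]
  {G : Type*} [NormedAddCommGroup G] [NormedSpace ℝ G]

theorem ContDiffAt.differentiableAt_fderiv_apply {f : E → F} {x : E} (hf : ContDiffAt ℝ 2 f x)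
    (v : E) : DifferentiableAt ℝ (fun y => fderiv ℝ f y v) x :=
  ((hf.fderiv_right (m := 1) (by norm_num)).differentiableAt (by simp)).clm_apply
    (differentiableAt_const _)

/-- Used with `k` a change of chart on the hypersurface: the last term lies in the range of `Df`, so
it disappears when paired with a normal vector. -/
theorem fderiv_fderiv_comp_apply {f : F → G} {k : E → F} {x : E} (hf : ContDiffAt ℝ 2 f (k x))
    (hk : ContDiffAt ℝ 2 k x) (v w : E) :
    fderiv ℝ (fun y => fderiv ℝ (f ∘ k) y w) x v =
      fderiv ℝ (fun z => fderiv ℝ f z (fderiv ℝ k x w)) (k x) (fderiv ℝ k x v)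
        + fderiv ℝ f (k x) (fderiv ℝ (fun y => fderiv ℝ k y w) x v) := by
  have hev : (fun y => fderiv ℝ (f ∘ k) y w) =ᶠ[𝓝 x]
      fun y => fderiv ℝ f (k y) (fderiv ℝ k y w) := by
    filter_upwards [hk.continuousAt.eventually (hf.eventually (by simp)),
      hk.eventually (by simp)] with y hy hy'
    rw [fderiv_comp y (hy.differentiableAt (by simp)) (hy'.differentiableAt (by simp))]
    rfl
  have hf' : DifferentiableAt ℝ (fderiv ℝ f) (k x) :=
    (hf.fderiv_right (m := 1) (by norm_num)).differentiableAt (by simp)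
  have hk' := hk.differentiableAt (by simp)
  have h1 := (hf'.hasFDerivAt.comp x hk'.hasFDerivAt).clm_apply
    (hk.differentiableAt_fderiv_apply w).hasFDerivAt
  have h2 := hf'.hasFDerivAt.clm_apply (hasFDerivAt_const (fderiv ℝ k x w) (k x))
  rw [hev.fderiv_eq, h2.fderiv]
  erw [h1.fderiv]
  simp [add_comm]

/-- The Christoffel symbols of the first kind of a field of bilinear forms on a vector space. -/
def flatChristoffel (b : E → E → E → ℝ) (x u v w : E) : ℝ :=
  (fderiv ℝ (fun y => b y v w) x u + fderiv ℝ (fun y => b y u w) x v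
    - fderiv ℝ (fun y => b y u v) x w) / 2

theorem flatChristoffel_congr {b b' : E → E → E → ℝ} {x : E}
    (h : ∀ᶠ y in 𝓝 x, ∀ u v, b y u v = b' y u v) (u v w : E) :
    flatChristoffel b x u v w = flatChristoffel b' x u v w := by
  have key : ∀ u v : E, fderiv ℝ (fun y => b y u v) x = fderiv ℝ (fun y => b' y u v) x := by
    intro u v
    refine Filter.EventuallyEq.fderiv_eq ?_
    filter_upwards [h] with y hy using hy u v
  simp only [flatChristoffel, key]

theorem fderiv_bilinear_apply {B : E → E →L[ℝ] E →L[ℝ] ℝ} {x : E} (hB : DifferentiableAt ℝ B x)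
    (u v w : E) : fderiv ℝ (fun y => B y u v) x w = fderiv ℝ B x w u v := by
  have h := (hB.hasFDerivAt.clm_apply (hasFDerivAt_const u x)).clm_apply (hasFDerivAt_const v x)
  rw [h.fderiv]
  simp

/-- Linearity in the last slot, which allows the normal vector to be split into its tangential part
and a multiple of `∂_t`. -/
theorem flatChristoffel_add_smul {B : E → E →L[ℝ] E →L[ℝ] ℝ} {x : E} (hB : DifferentiableAt ℝ B x)
    (u v p q : E) (α β : ℝ) :
    flatChristoffel (fun y u v => B y u v) x u v (α • p + β • q) =
      α * flatChristoffel (fun y u v => B y u v) x u v p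
        + β * flatChristoffel (fun y u v => B y u v) x u v q := by
  simp only [flatChristoffel, fderiv_bilinear_apply hB]
  simp only [map_add, map_smul, add_apply, smul_apply, smul_eq_mul]
  ring

/-- Naturality of the Christoffel symbols of the first kind under pullback. -/
theorem flatChristoffel_pullback {B : F → F →L[ℝ] F →L[ℝ] ℝ} {W : E → F} {y : E}
    (hB : DifferentiableAt ℝ B (W y)) (hsymm : ∀ x u v, B x u v = B x v u)
    (hW : ContDiffAt ℝ 2 W y) (a b c : E) :
    flatChristoffel (fun y a b => B (W y) (fderiv ℝ W y a) (fderiv ℝ W y b)) y a b c =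
      flatChristoffel (fun x u v => B x u v) (W y) (fderiv ℝ W y a) (fderiv ℝ W y b)
          (fderiv ℝ W y c)
        + B (W y) (fderiv ℝ (fun z => fderiv ℝ W z b) y a) (fderiv ℝ W y c) := by
  have hWd := (hW.differentiableAt (by simp)).hasFDerivAt
  have key : ∀ a b c : E,
      fderiv ℝ (fun y => B (W y) (fderiv ℝ W y a) (fderiv ℝ W y b)) y c =
        fderiv ℝ B (W y) (fderiv ℝ W y c) (fderiv ℝ W y a) (fderiv ℝ W y b)
          + B (W y) (fderiv ℝ (fun z => fderiv ℝ W z a) y c) (fderiv ℝ W y b)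
          + B (W y) (fderiv ℝ W y a) (fderiv ℝ (fun z => fderiv ℝ W z b) y c) := by
    intro a b c
    have h0 : HasFDerivAt (fun y => B (W y)) ((fderiv ℝ B (W y)).comp (fderiv ℝ W y)) y :=
      HasFDerivAt.comp (g := B) (f := W) y hB.hasFDerivAt hWd
    have h1 : HasFDerivAt (fun y => B (W y) (fderiv ℝ W y a)) _ y :=
      h0.clm_apply (hW.differentiableAt_fderiv_apply a).hasFDerivAt
    have h : HasFDerivAt (fun y => B (W y) (fderiv ℝ W y a) (fderiv ℝ W y b)) _ y :=
      h1.clm_apply (hW.differentiableAt_fderiv_apply b).hasFDerivAt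
    rw [h.fderiv]
    simp only [add_apply, ContinuousLinearMap.comp_apply, ContinuousLinearMap.flip_apply]
    ring
  -- With second derivatives symmetric, four of the six terms containing `D²W` in the Koszul
  -- combination cancel in pairs and the remaining two coincide.
  have hs : ∀ a b : E, fderiv ℝ (fun z => fderiv ℝ W z a) y b =
      fderiv ℝ (fun z => fderiv ℝ W z b) y a := by
    intro a b
    have hW' : DifferentiableAt ℝ (fderiv ℝ W) y :=
      (hW.fderiv_right (m := 1) (by norm_num)).differentiableAt (by simp)
    have h2 : ∀ a b : E, fderiv ℝ (fun z => fderiv ℝ W z a) y b =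
        fderiv ℝ (fderiv ℝ W) y b a := by
      intro a b
      rw [(hW'.hasFDerivAt.clm_apply (hasFDerivAt_const a y)).fderiv]
      simp
    rw [h2, h2]
    exact (hW.isSymmSndFDerivAt (by simp)).eq b a
  simp only [flatChristoffel, key, fderiv_bilinear_apply hB]
  rw [hsymm (W y) (fderiv ℝ W y b), hsymm (W y) (fderiv ℝ W y a), hs c a, hs c b, hs a b,
    hsymm (W y) (fderiv ℝ W y a)]
  ring

end FlatChristoffel

/-! ### The warped metric in coordinates and the differential inequality for the time component. -/

section FlatWarped

variable {E : Type*} [NormedAddCommGroup E] [NormedSpace ℝ E]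

theorem DifferentiableAt.warped_add {Y Z : Type*} [NormedAddCommGroup Y] [NormedSpace ℝ Y]
    [NormedAddCommGroup Z] [NormedSpace ℝ Z] (A : Z) (K : Y →L[ℝ] Z) {h : E → ℝ} {r : ℝ → ℝ}
    {s : E → Y} {q : ℝ × E} (hh : DifferentiableAt ℝ h q.2) (hr : DifferentiableAt ℝ r q.1)
    (hs : DifferentiableAt ℝ s q.2) :
    DifferentiableAt ℝ (fun q : ℝ × E => (-(h q.2) ^ 2) • A + (r q.1) ^ 2 • K (s q.2)) q := by
  have h1 : DifferentiableAt ℝ (fun q : ℝ × E => h q.2) q := hh.comp q differentiableAt_snd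
  have h2 : DifferentiableAt ℝ (fun q : ℝ × E => r q.1) q := hr.comp q differentiableAt_fst
  have h3 : DifferentiableAt ℝ (fun q : ℝ × E => s q.2) q := hs.comp q differentiableAt_snd
  exact ((h1.pow 2).neg.smul_const A).add ((h2.pow 2).smul (K.differentiableAt.comp q h3))

/-- The form `-h(x)² dt² + r(t)² s_x` on `ℝ × E`. -/
def warpedForm (h : E → ℝ) (r : ℝ → ℝ) (s : E → E →L[ℝ] E →L[ℝ] ℝ) (q : ℝ × E) :
    (ℝ × E) →L[ℝ] (ℝ × E) →L[ℝ] ℝ :=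
  (-(h q.2) ^ 2) • (ContinuousLinearMap.mul ℝ ℝ).bilinearComp (.fst ℝ ℝ E) (.fst ℝ ℝ E)
    + (r q.1) ^ 2 • (ContinuousLinearMap.bilinearComp (s q.2) (.snd ℝ ℝ E) (.snd ℝ ℝ E))

theorem warpedForm_apply (h : E → ℝ) (r : ℝ → ℝ) (s : E → E →L[ℝ] E →L[ℝ] ℝ) (q u v : ℝ × E) :
    warpedForm h r s q u v = -(h q.2) ^ 2 * (u.1 * v.1) + (r q.1) ^ 2 * s q.2 u.2 v.2 := by
  simp [warpedForm]

variable {h : E → ℝ} {r : ℝ → ℝ} {s : E → E →L[ℝ] E →L[ℝ] ℝ} {q : ℝ × E}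

theorem differentiableAt_warpedForm (hh : DifferentiableAt ℝ h q.2)
    (hr : DifferentiableAt ℝ r q.1) (hs : DifferentiableAt ℝ s q.2) :
    DifferentiableAt ℝ (warpedForm h r s) q := by
  have hK : ∃ K : (E →L[ℝ] E →L[ℝ] ℝ) →L[ℝ] ((ℝ × E) →L[ℝ] (ℝ × E) →L[ℝ] ℝ),
      ∀ b u v, K b u v = b u.2 v.2 := by
    let S : (E →L[ℝ] ℝ) →L[ℝ] ((ℝ × E) →L[ℝ] ℝ) :=
      (ContinuousLinearMap.compL ℝ (ℝ × E) E ℝ).flip (.snd ℝ ℝ E)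
    let T : (E →L[ℝ] (ℝ × E) →L[ℝ] ℝ) →L[ℝ] ((ℝ × E) →L[ℝ] (ℝ × E) →L[ℝ] ℝ) :=
      (ContinuousLinearMap.compL ℝ (ℝ × E) E ((ℝ × E) →L[ℝ] ℝ)).flip (.snd ℝ ℝ E)
    exact ⟨T.comp (ContinuousLinearMap.compL ℝ E (E →L[ℝ] ℝ) ((ℝ × E) →L[ℝ] ℝ) S),
      fun b u v => rfl⟩
  obtain ⟨K, hK⟩ := hK
  obtain ⟨A, hA⟩ : ∃ A : (ℝ × E) →L[ℝ] (ℝ × E) →L[ℝ] ℝ, ∀ u v, A u v = u.1 * v.1 :=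
    ⟨(ContinuousLinearMap.mul ℝ ℝ).bilinearComp (.fst ℝ ℝ E) (.fst ℝ ℝ E), fun u v => rfl⟩
  have heq : warpedForm h r s = fun q : ℝ × E => (-(h q.2) ^ 2) • A + (r q.1) ^ 2 • K (s q.2) := by
    funext q
    refine ContinuousLinearMap.ext fun u => ContinuousLinearMap.ext fun v => ?_
    rw [warpedForm_apply]
    simp only [add_apply, smul_apply, hA, hK, smul_eq_mul]
  have := DifferentiableAt.warped_add (Y := E →L[ℝ] E →L[ℝ] ℝ)
    (Z := (ℝ × E) →L[ℝ] (ℝ × E) →L[ℝ] ℝ) (s := s) A K hh hr hs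
  rw [heq]
  exact this

/-- The Christoffel symbols of a doubly warped product in the direction of `∂_t`. -/
theorem flatChristoffel_warpedForm_time (hh : DifferentiableAt ℝ h q.2)
    (hr : DifferentiableAt ℝ r q.1) (hs : DifferentiableAt ℝ s q.2) (v : ℝ × E) :
    flatChristoffel (fun x u v => warpedForm h r s x u v) q v v (1, 0) =
      -2 * h q.2 * fderiv ℝ h q.2 v.2 * v.1 - r q.1 * deriv r q.1 * s q.2 v.2 v.2
        := by
  simp only [flatChristoffel, warpedForm_apply, map_zero, mul_zero, add_zero, mul_one]
  have h1 : HasFDerivAt (fun y : ℝ × E => -h y.2 ^ 2 * v.1) _ q :=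
    (((hh.hasFDerivAt.comp q hasFDerivAt_snd).pow 2).neg).mul_const v.1
  have h2 : fderiv ℝ (fun y : ℝ × E => -h y.2 ^ 2 * (v.1 * v.1) + r y.1 ^ 2 * s y.2 v.2 v.2) q
      (1, 0) = 2 * r q.1 * deriv r q.1 * s q.2 v.2 v.2 := by
    have hs' : DifferentiableAt ℝ (fun x => s x v.2 v.2) q.2 :=
      (hs.clm_apply (differentiableAt_const _)).clm_apply (differentiableAt_const _)
    have h3 : HasFDerivAt
        (fun y : ℝ × E => -h y.2 ^ 2 * (v.1 * v.1) + r y.1 ^ 2 * s y.2 v.2 v.2) _ q :=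
      ((((hh.hasFDerivAt.comp q hasFDerivAt_snd).pow 2).neg).mul_const (v.1 * v.1)).add
        (((hr.hasFDerivAt.comp q hasFDerivAt_fst).pow 2).mul
          (hs'.hasFDerivAt.comp q hasFDerivAt_snd))
    rw [h3.fderiv]
    simp
    ring
  rw [h1.fderiv, h2]
  simp
  ring

/-- The second order differential inequality for the time component `W.1` of a spacelike
hypersurface `W` of a doubly warped product whose mean curvature is at least that of the slices. -/
theorem warped_time_subsolution [FiniteDimensional ℝ E] {ι : Type*} [Fintype ι] {W : E → ℝ × E}
    {y : E} (hW : ContDiffAt ℝ 2 W y)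
    (hh : DifferentiableAt ℝ h (W y).2) (hhpos : 0 < h (W y).2)
    (hr : DifferentiableAt ℝ r (W y).1) (hrpos : 0 < r (W y).1) (hr' : 0 ≤ deriv r (W y).1)
    (hs : DifferentiableAt ℝ s (W y).2) (hsymm : ∀ x u v, s x u v = s x v u)
    (hpos : ∀ v, v ≠ 0 → 0 < warpedForm h r s (W y) (fderiv ℝ W y v) (fderiv ℝ W y v))
    {n : ℝ × E} (hn : ∀ v, warpedForm h r s (W y) n (fderiv ℝ W y v) = 0)
    (hnn : warpedForm h r s (W y) n n = -1) (hn0 : 0 < n.1)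
    {a : ι → E} (ha : ∀ i, warpedForm h r s (W y) (fderiv ℝ W y (a i)) (fderiv ℝ W y (a i)) = 1)
    (hspan : ∀ z, z = ∑ i, warpedForm h r s (W y) (fderiv ℝ W y z) (fderiv ℝ W y (a i)) • a i)
    (hH : ∑ i, (warpedForm h r s (W y) (fderiv ℝ (fun z => fderiv ℝ W z (a i)) y (a i)) n
        + flatChristoffel (fun x u v => warpedForm h r s x u v) (W y) (fderiv ℝ W y (a i))
          (fderiv ℝ W y (a i)) n)
      ≤ -(Fintype.card ι * (deriv r (W y).1 / (r (W y).1 * h (W y).2)))) :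
    0 ≤ ∑ i, (fderiv ℝ (fun z => fderiv ℝ (fun x => (W x).1) z (a i)) y (a i)
      - flatChristoffel (fun x u v => warpedForm h r s (W x) (fderiv ℝ W x u) (fderiv ℝ W x v)) y
          (a i) (a i) (∑ j, fderiv ℝ (fun x => (W x).1) y (a j) • a j)
      + 2 / h (W y).2 * fderiv ℝ (fun x => h (W x).2) y (a i) * fderiv ℝ (fun x => (W x).1) y (a i)
      + deriv r (W y).1 / r (W y).1 * fderiv ℝ (fun x => (W x).1) y (a i) ^ 2) := by
  set B := warpedForm h r s with hBdef
  have hB : DifferentiableAt ℝ B (W y) := differentiableAt_warpedForm hh hr hs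
  have hBsymm : ∀ x u v, B x u v = B x v u := fun x u v => by
    simp only [hBdef, warpedForm_apply]; rw [hsymm, mul_comm u.1]
  have hWd := hW.differentiableAt (by simp)
  set A := fderiv ℝ W y with hA
  have hu1 : ∀ x, DifferentiableAt ℝ W x → ∀ v,
      fderiv ℝ (fun x => (W x).1) x v = (fderiv ℝ W x v).1 := fun x hx v => by
    rw [hx.hasFDerivAt.fst.fderiv]; rfl
  have hu : ∀ v, fderiv ℝ (fun x => (W x).1) y v = (A v).1 := hu1 y hWd
  have hu2 : ∀ v, fderiv ℝ (fun z => fderiv ℝ (fun x => (W x).1) z v) y v =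
      (fderiv ℝ (fun z => fderiv ℝ W z v) y v).1 := fun v => by
    have hev : (fun z => fderiv ℝ (fun x => (W x).1) z v) =ᶠ[𝓝 y]
        fun z => (fderiv ℝ W z v).1 := by
      filter_upwards [hW.eventually (by simp)] with z hz
      exact hu1 z (hz.differentiableAt (by simp)) v
    rw [hev.fderiv_eq, (hW.differentiableAt_fderiv_apply v).hasFDerivAt.fst.fderiv]
    rfl
  have hh' : ∀ v, fderiv ℝ (fun x => h (W x).2) y v = fderiv ℝ h (W y).2 (A v).2 := fun v => by
    have h1 : HasFDerivAt (fun x => h (W x).2) _ y :=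
      hh.hasFDerivAt.comp y hWd.hasFDerivAt.snd
    rw [h1.fderiv]; rfl
  simp only [hu, hu2, hh']
  set η := h (W y).2 with hη
  set ρ := r (W y).1 with hρ
  set ρ' := deriv r (W y).1 with hρ'
  set Z := ∑ j, (A (a j)).1 • a j with hZ
  set S := ∑ j, (A (a j)).1 ^ 2 with hS
  have hS0 : 0 ≤ S := Finset.sum_nonneg fun j _ => sq_nonneg _
  -- A nonzero tangent vector without spatial part would not be spacelike. So the tangent space
  -- projects isomorphically onto the spatial factor, and `n` differs from a tangent vector `A z` by
  -- a multiple `c` of `∂_t`.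
  obtain ⟨z, hz⟩ : ∃ z, (A z).2 = n.2 := by
    let A₂ : E →ₗ[ℝ] E := ((ContinuousLinearMap.snd ℝ ℝ E).comp A : E →L[ℝ] E)
    have hinj : Function.Injective A₂ := by
      rw [injective_iff_map_eq_zero]
      intro v hv
      by_contra hne
      have h1 := hpos v hne
      have hv' : (A v).2 = 0 := hv
      rw [hBdef, warpedForm_apply, hv'] at h1
      simp only [map_zero, mul_zero, add_zero] at h1
      nlinarith [mul_self_nonneg (A v).1, sq_nonneg (h (W y).2)]
    exact (LinearMap.injective_iff_surjective.1 hinj) n.2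
  set c := n.1 - (A z).1 with hc
  set e : ℝ × E := (1, 0) with he
  have hne : n = A z + c • e := by
    ext
    · simp [he, hc]
    · simp [he, hz]
  have hBe : ∀ u, B (W y) u e = -η ^ 2 * u.1 := fun u => by
    simp [hBdef, warpedForm_apply, he, hη]
  have hcn : c * η ^ 2 * n.1 = 1 := by
    have h1 : B (W y) n n = B (W y) n (A z) + c * B (W y) n e := by
      conv_lhs => rw [hne, map_add (B (W y) (A z + c • e)), map_smul, ← hne]
      rfl
    rw [hn, hnn, hBe] at h1
    linarith
  have hη2 : 0 < η ^ 2 := by positivity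
  have hcpos : 0 < c := by
    by_contra! hle
    nlinarith [mul_pos hη2 hn0]
  -- Orthogonality of `n` to the tangent space says that `z` represents `c η² dτ` in the induced
  -- metric, that is, `z = c η² Z` with `Z` the gradient of `τ`.
  have hzw : ∀ w, B (W y) (A z) (A w) = c * η ^ 2 * (A w).1 := fun w => by
    have h1 : A z = n - c • e := by rw [hne]; simp
    rw [h1, map_sub, map_smul, sub_apply, smul_apply, hn, hBsymm, hBe, smul_eq_mul]
    ring
  have hzZ : z = (c * η ^ 2) • Z := by
    rw [hspan z, hZ, Finset.smul_sum]
    exact Finset.sum_congr rfl fun j _ => by rw [hzw, smul_smul]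
  have hAZ : (A Z).1 = S := by
    rw [hZ, map_sum, Prod.fst_sum]
    exact Finset.sum_congr rfl fun j _ => by simp [sq]
  have hn1 : n.1 = c + c * η ^ 2 * S := by
    have : (A z).1 = c * η ^ 2 * S := by rw [hzZ, map_smul, Prod.smul_fst, hAZ, smul_eq_mul]
    rw [← this, hc]; ring
  -- Normalization gives `(c η)² (1 + η² S) = 1` with `S = |∇τ|² ≥ 0`.
  have hcη : c * η ≤ 1 := by
    have h1 : (c * η) ^ 2 * (1 + η ^ 2 * S) = 1 := by rw [hn1] at hcn; linarith
    have h2 : (c * η) ^ 2 ≤ 1 := by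
      have : 0 ≤ (c * η) ^ 2 * (η ^ 2 * S) := by positivity
      linarith
    have : 0 < c * η := by positivity
    nlinarith
  have hnZ : n = (c * η ^ 2) • A Z + c • e := by rw [← map_smul, ← hzZ]; exact hne
  -- Along the tangential part of `n`, the pullback formula gives the Christoffel symbol of the
  -- induced metric. Along `∂_t`, the unit length of `A (a i)` replaces `ρ² s` by `1 + η² τᵢ²`: the
  -- `1` yields `c ρ'/ρ` and the rest the quadratic gradient term.
  have hterm : ∀ i, B (W y) (fderiv ℝ (fun z => fderiv ℝ W z (a i)) y (a i)) n
      + flatChristoffel (fun x u v => B x u v) (W y) (A (a i)) (A (a i)) n =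
      -(c * η ^ 2) * ((fderiv ℝ (fun z => fderiv ℝ W z (a i)) y (a i)).1
        - flatChristoffel (fun x u v => B (W x) (fderiv ℝ W x u) (fderiv ℝ W x v)) y
            (a i) (a i) Z
        + 2 / η * fderiv ℝ h (W y).2 (A (a i)).2 * (A (a i)).1 + ρ' / ρ * (A (a i)).1 ^ 2)
      - c * (ρ' / ρ) := by
    intro i
    have hs1 : ρ ^ 2 * s (W y).2 (A (a i)).2 (A (a i)).2 = 1 + η ^ 2 * (A (a i)).1 ^ 2 := by
      have := ha i
      rw [hBdef, warpedForm_apply] at this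
      linarith
    have hs2 : ρ * ρ' * s (W y).2 (A (a i)).2 (A (a i)).2 =
        ρ' / ρ * (1 + η ^ 2 * (A (a i)).1 ^ 2) := by
      rw [← hs1]; field_simp
    rw [flatChristoffel_pullback hB hBsymm hW, ← hA, hnZ, flatChristoffel_add_smul hB, map_add,
      map_smul, map_smul, hBe, hBdef, flatChristoffel_warpedForm_time hh hr hs, ← hη, ← hρ, ← hρ',
      hs2, smul_eq_mul, smul_eq_mul]
    field_simp
    ring
  simp only [hterm] at hH
  rw [Finset.sum_sub_distrib, ← Finset.mul_sum, Finset.sum_const, nsmul_eq_mul,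
    Finset.card_univ] at hH
  set X := ∑ i, ((fderiv ℝ (fun z => fderiv ℝ W z (a i)) y (a i)).1
        - flatChristoffel (fun x u v => B (W x) (fderiv ℝ W x u) (fderiv ℝ W x v)) y
            (a i) (a i) Z
        + 2 / η * fderiv ℝ h (W y).2 (A (a i)).2 * (A (a i)).1 + ρ' / ρ * (A (a i)).1 ^ 2)
  have h1 : ρ' / (ρ * η) = ρ' / ρ * (1 / η) := by field_simp
  have h2 : c ≤ 1 / η := by rw [le_div_iff₀ hhpos]; exact hcη
  -- The only place where the sign of `ρ'` enters: it absorbs the tilt of the normal against `∂_t`.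
  have h3 : 0 ≤ (Fintype.card ι : ℝ) * (ρ' / ρ) * (1 / η - c) :=
    mul_nonneg (mul_nonneg (Nat.cast_nonneg _) (div_nonneg hr' hrpos.le)) (sub_nonneg.2 h2)
  rw [h1] at hH
  have h4 : 0 ≤ (c * η ^ 2) * X := by linarith
  exact nonneg_of_mul_nonneg_right h4 (by positivity)

end FlatWarped

/-! ### Smoothness of a metric read in a chart. -/

section ChartForm

variable {m : ℕ} {P : Type*} [TopologicalSpace P] [ChartedSpace (Euc m) P] [IsManifold (𝓡 m) ∞ P]

/-- A coordinate field is the tangent map of the inverse chart applied to a constant section, hence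
smooth as a section of the tangent bundle. -/
theorem contMDiffOn_mfderiv_extChartAt_symm_apply (q : P) (a : Euc m) :
    ContMDiffOn 𝓘(ℝ, Euc m) ((𝓡 m).prod 𝓘(ℝ, Euc m)) ∞
      (fun y => (TotalSpace.mk' (Euc m) ((extChartAt (𝓡 m) q).symm y)
        (mfderiv 𝓘(ℝ, Euc m) (𝓡 m) (extChartAt (𝓡 m) q).symm y a) :
          TotalSpace (Euc m) (fun x : P => TangentSpace (𝓡 m) x)))
      (extChartAt (𝓡 m) q).target := by
  have hopen : IsOpen (extChartAt (𝓡 m) q).target := isOpen_extChartAt_target q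
  have h1 := (contMDiffOn_extChartAt_symm (I := 𝓡 m) (n := ∞) q).contMDiffOn_tangentMapWithin
    (m := ∞) (by simp) hopen.uniqueMDiffOn
  have h2 : ContMDiff 𝓘(ℝ, Euc m) (𝓘(ℝ, Euc m).tangent) ∞
      (fun y : Euc m => (⟨y, a⟩ : TangentBundle 𝓘(ℝ, Euc m) (Euc m))) := by
    rw [← contMDiffOn_univ]
    intro y _
    rw [contMDiffWithinAt_totalSpace]
    refine ⟨contMDiffWithinAt_id, ?_⟩
    simpa using contMDiffWithinAt_const
  have h3 := h1.comp h2.contMDiffOn (s := (extChartAt (𝓡 m) q).target) (fun y hy => hy)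
  refine h3.congr fun y hy => ?_
  simp only [Function.comp, tangentMapWithin]
  rw [mfderivWithin_of_isOpen hopen hy]

/-- A field of bilinear forms on the tangent spaces, read in the preferred chart at `q`. -/
def formInChart (g : ∀ x : P, TangentSpace (𝓡 m) x →L[ℝ] TangentSpace (𝓡 m) x →L[ℝ] ℝ) (q : P)
    (y : Euc m) : Euc m →L[ℝ] Euc m →L[ℝ] ℝ :=
  (show Euc m →L[ℝ] Euc m →L[ℝ] ℝ from g ((extChartAt (𝓡 m) q).symm y)).bilinearComp
    (show Euc m →L[ℝ] Euc m from mfderiv 𝓘(ℝ, Euc m) (𝓡 m) (extChartAt (𝓡 m) q).symm y)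
    (show Euc m →L[ℝ] Euc m from mfderiv 𝓘(ℝ, Euc m) (𝓡 m) (extChartAt (𝓡 m) q).symm y)

theorem contDiffOn_formInChart
    {g : ∀ x : P, TangentSpace (𝓡 m) x →L[ℝ] TangentSpace (𝓡 m) x →L[ℝ] ℝ}
    (hg : ContMDiff (𝓡 m) ((𝓡 m).prod 𝓘(ℝ, Euc m →L[ℝ] Euc m →L[ℝ] ℝ)) ∞
      (fun b ↦ TotalSpace.mk' (Euc m →L[ℝ] Euc m →L[ℝ] ℝ) b (g b))) (q : P) :
    ContDiffOn ℝ ∞ (formInChart g q) (extChartAt (𝓡 m) q).target := by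
  refine contDiffOn_clm_apply.2 fun a => contDiffOn_clm_apply.2 fun b => ?_
  rw [← contMDiffOn_iff_contDiffOn]
  intro y hy
  have hs := (contMDiffOn_extChartAt_symm (I := 𝓡 m) (n := ∞) q) y hy
  have : ContMDiffWithinAt 𝓘(ℝ, Euc m) ((𝓡 m).prod 𝓘(ℝ)) ∞
      (fun y ↦ TotalSpace.mk' ℝ (E := Bundle.Trivial P ℝ) ((extChartAt (𝓡 m) q).symm y)
        (g ((extChartAt (𝓡 m) q).symm y)
          (mfderiv 𝓘(ℝ, Euc m) (𝓡 m) (extChartAt (𝓡 m) q).symm y a)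
          (mfderiv 𝓘(ℝ, Euc m) (𝓡 m) (extChartAt (𝓡 m) q).symm y b)))
      (extChartAt (𝓡 m) q).target y := by
    apply ContMDiffWithinAt.clm_bundle_apply₂ (F₁ := Euc m) (F₂ := Euc m)
    · exact ContMDiffAt.comp_contMDiffWithinAt y hg.contMDiffAt hs
    · exact contMDiffOn_mfderiv_extChartAt_symm_apply q a y hy
    · exact contMDiffOn_mfderiv_extChartAt_symm_apply q b y hy
  simp only [contMDiffWithinAt_totalSpace] at this
  exact this.2

end ChartForm

/-! ### Surjectivity of local homotheties from a complete manifold. -/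

/-- A completeness principle of Caristi type: if every point of the closed set `A` with `0 < f` can
be moved inside `A` so that `f` decreases at least proportionally to the distance moved, then `f`
vanishes somewhere on `A`. -/
theorem exists_eq_zero_of_decrease {X : Type*} [EMetricSpace X] [CompleteSpace X] {A : Set X}
    (hA : IsClosed A) (hne : A.Nonempty) {f : X → ℝ} (hf : ContinuousOn f A)
    (hf0 : ∀ x ∈ A, 0 ≤ f x) {C : ℝ} (hC : 0 ≤ C)
    (hdec : ∀ x ∈ A, 0 < f x → ∃ y ∈ A, f y < f x ∧ edist x y ≤ ENNReal.ofReal (C * (f x - f y))) :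
    ∃ x ∈ A, f x = 0 := by
  -- `S x` is the set of points reachable from `x` at admissible cost; the relation is reflexive on
  -- `A` and transitive because the costs telescope.
  let S : X → Set X := fun x =>
    {y | y ∈ A ∧ f y ≤ f x ∧ edist x y ≤ ENNReal.ofReal (C * (f x - f y))}
  have hSself : ∀ x ∈ A, x ∈ S x := fun x hx => ⟨hx, le_rfl, by simp⟩
  have hStrans : ∀ x y z, y ∈ S x → z ∈ S y → z ∈ S x := by
    rintro x y z ⟨-, h1, h2⟩ ⟨h3, h4, h5⟩
    refine ⟨h3, h4.trans h1, (edist_triangle x y z).trans ((add_le_add h2 h5).trans ?_)⟩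
    rw [← ENNReal.ofReal_add (mul_nonneg hC (by linarith)) (mul_nonneg hC (by linarith))]
    exact ENNReal.ofReal_le_ofReal (by linarith)
  have hbdd : ∀ x, BddBelow (f '' S x) := fun x => ⟨0, by
    rintro _ ⟨y, hy, rfl⟩; exact hf0 y hy.1⟩
  -- Each successor nearly minimizes `f` over the reachable set. The limit `x` is reachable from
  -- every term, so a further decrease from `x` would contradict near-minimality.
  have hstep : ∀ (n : ℕ) (x : A), ∃ y : A, (y : X) ∈ S x ∧
      ∀ z ∈ S x, f y ≤ f z + (1 / 2) ^ n := by
    intro n x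
    have hxne : (S x).Nonempty := ⟨x, hSself x x.2⟩
    obtain ⟨_, ⟨y, hy, rfl⟩, hlt⟩ := exists_lt_of_csInf_lt (hxne.image f)
      (lt_add_of_pos_right (sInf (f '' S x)) (by positivity : (0 : ℝ) < (1 / 2) ^ n))
    exact ⟨⟨y, hy.1⟩, hy, fun z hz => by
      have := csInf_le (hbdd x) (mem_image_of_mem f hz)
      change f y ≤ _
      linarith⟩
  choose next hnextS hnext using hstep
  obtain ⟨x₀, hx₀⟩ := hne
  let u : ℕ → A := fun n => Nat.rec ⟨x₀, hx₀⟩ (fun n x => next n x) n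
  have husucc : ∀ n, u (n + 1) = next n (u n) := fun n => rfl
  have huS : ∀ n, (u (n + 1)).1 ∈ S (u n).1 := fun n => by
    rw [husucc]; exact hnextS n (u n)
  have hmono : ∀ n k, (u (n + k)).1 ∈ S (u n).1 := by
    intro n k
    induction k with
    | zero => exact hSself _ (u n).2
    | succ k ih => exact hStrans _ (u (n + k)).1 _ ih (huS (n + k))
  have hcauchy : CauchySeq (fun n => (u n).1) := by
    refine cauchySeq_of_edist_le_of_tsum_ne_top
      (fun n => ENNReal.ofReal (C * (f (u n).1 - f (u (n + 1)).1))) (fun n => (huS n).2.2) ?_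
    have hle : ∀ N, ∑ n ∈ Finset.range N, ENNReal.ofReal (C * (f (u n).1 - f (u (n + 1)).1)) ≤
        ENNReal.ofReal (C * f (u 0).1) := by
      intro N
      rw [← ENNReal.ofReal_sum_of_nonneg fun n _ => mul_nonneg hC (sub_nonneg.2 (huS n).2.1),
        ← Finset.mul_sum, Finset.sum_range_sub']
      refine ENNReal.ofReal_le_ofReal (mul_le_mul_of_nonneg_left ?_ hC)
      linarith [hf0 _ (u N).2]
    exact ne_top_of_le_ne_top ENNReal.ofReal_ne_top (ENNReal.tsum_le_of_sum_range_le hle)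
  obtain ⟨x, hx⟩ := cauchySeq_tendsto_of_complete hcauchy
  have hxA : x ∈ A := hA.mem_of_tendsto hx (Eventually.of_forall fun n => (u n).2)
  have hfx : Tendsto (fun n => f (u n).1) atTop (𝓝 (f x)) :=
    (hf x hxA).tendsto.comp (tendsto_nhdsWithin_iff.2 ⟨hx, Eventually.of_forall fun n => (u n).2⟩)
  have hxS : ∀ n, x ∈ S (u n).1 := by
    intro n
    refine ⟨hxA, ?_, ?_⟩
    · refine le_of_tendsto hfx (eventually_atTop.2 ⟨n, fun k hk => ?_⟩)
      obtain ⟨j, rfl⟩ := Nat.exists_eq_add_of_le hk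
      exact (hmono n j).2.1
    · have h1 : Tendsto (fun k => edist (u n).1 (u k).1) atTop (𝓝 (edist (u n).1 x)) :=
        tendsto_const_nhds.edist hx
      have h2 : Tendsto (fun k => ENNReal.ofReal (C * (f (u n).1 - f (u k).1))) atTop
          (𝓝 (ENNReal.ofReal (C * (f (u n).1 - f x)))) :=
        ENNReal.tendsto_ofReal ((tendsto_const_nhds.sub hfx).const_mul C)
      refine le_of_tendsto_of_tendsto h1 h2 (eventually_atTop.2 ⟨n, fun k hk => ?_⟩)
      obtain ⟨j, rfl⟩ := Nat.exists_eq_add_of_le hk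
      exact (hmono n j).2.2
  refine ⟨x, hxA, le_antisymm ?_ (hf0 x hxA)⟩
  by_contra! hpos
  obtain ⟨y, hyA, hlt, hd⟩ := hdec x hxA hpos
  have hy : ∀ n, f (u (n + 1)).1 ≤ f y + (1 / 2) ^ n := fun n => by
    rw [husucc]
    exact hnext n (u n) y (hStrans _ _ _ (hxS n) ⟨hyA, hlt.le, hd⟩)
  have h1 : Tendsto (fun n : ℕ => f y + (1 / 2 : ℝ) ^ n) atTop (𝓝 (f y + 0)) :=
    tendsto_const_nhds.add (tendsto_pow_atTop_nhds_zero_of_lt_one (by norm_num) (by norm_num))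
  have h2 := le_of_tendsto_of_tendsto' (hfx.comp (tendsto_add_atTop_nat 1)) h1 hy
  linarith

/-- The chain rule for two factorizations of the same map; the tangent spaces are identified with
the model space, so that no transport along the equality of the end points is needed. -/
theorem mfderiv_mfderiv_eq_of_comp_eventuallyEq {E : Type*} [NormedAddCommGroup E]
    [NormedSpace ℝ E] {H : Type*} [TopologicalSpace H] {I : ModelWithCorners ℝ E H}
    {X : Type*} [TopologicalSpace X] [ChartedSpace H X]
    {E₁ : Type*} [NormedAddCommGroup E₁] [NormedSpace ℝ E₁] {H₁ : Type*} [TopologicalSpace H₁]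
    {I₁ : ModelWithCorners ℝ E₁ H₁} {X₁ : Type*} [TopologicalSpace X₁] [ChartedSpace H₁ X₁]
    {E₂ : Type*} [NormedAddCommGroup E₂] [NormedSpace ℝ E₂] {H₂ : Type*} [TopologicalSpace H₂]
    {I₂ : ModelWithCorners ℝ E₂ H₂} {X₂ : Type*} [TopologicalSpace X₂] [ChartedSpace H₂ X₂]
    {E' : Type*} [NormedAddCommGroup E'] [NormedSpace ℝ E'] {H' : Type*} [TopologicalSpace H']
    {I' : ModelWithCorners ℝ E' H'} {X' : Type*} [TopologicalSpace X'] [ChartedSpace H' X']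
    {f₁ : X → X₁} {g₁ : X₁ → X'} {f₂ : X → X₂} {g₂ : X₂ → X'} {x : X}
    (h : g₁ ∘ f₁ =ᶠ[𝓝 x] g₂ ∘ f₂)
    (hg₁ : MDifferentiableAt I₁ I' g₁ (f₁ x)) (hf₁ : MDifferentiableAt I I₁ f₁ x)
    (hg₂ : MDifferentiableAt I₂ I' g₂ (f₂ x)) (hf₂ : MDifferentiableAt I I₂ f₂ x) (v : E) :
    @Eq E' (mfderiv I₁ I' g₁ (f₁ x) (mfderiv I I₁ f₁ x v))
      (mfderiv I₂ I' g₂ (f₂ x) (mfderiv I I₂ f₂ x v)) := by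
  have h1 := mfderiv_comp_apply x hg₁ hf₁ v
  have h2 := mfderiv_comp_apply x hg₂ hf₂ v
  have h3 : mfderiv I I' (g₁ ∘ f₁) x = mfderiv I I' (g₂ ∘ f₂) x := h.mfderiv_eq
  exact h1.symm.trans ((congrArg (fun L : E →L[ℝ] E' => L v) h3).trans h2)

section ChartInverse

variable {m : ℕ} {P : Type*} [TopologicalSpace P] [ChartedSpace (Euc m) P] [IsManifold (𝓡 m) ∞ P]

theorem contMDiffAt_extChartAt_symm_of_mem_target {q : P} {y : Euc m}
    (hy : y ∈ (extChartAt (𝓡 m) q).target) :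
    ContMDiffAt 𝓘(ℝ, Euc m) (𝓡 m) ∞ (extChartAt (𝓡 m) q).symm y :=
  (contMDiffOn_extChartAt_symm (I := 𝓡 m) (n := ∞) q).contMDiffAt
    ((isOpen_extChartAt_target q).mem_nhds hy)

theorem mdifferentiableAt_extChartAt_symm_of_mem_target {q : P} {y : Euc m}
    (hy : y ∈ (extChartAt (𝓡 m) q).target) :
    MDifferentiableAt 𝓘(ℝ, Euc m) (𝓡 m) (extChartAt (𝓡 m) q).symm y :=
  (contMDiffAt_extChartAt_symm_of_mem_target hy).mdifferentiableAt (by simp)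

theorem mfderiv_extChartAt_symm_bijective {q : P} {y : Euc m}
    (hy : y ∈ (extChartAt (𝓡 m) q).target) :
    Function.Bijective (mfderiv 𝓘(ℝ, Euc m) (𝓡 m) (extChartAt (𝓡 m) q).symm y) := by
  have : IsManifold (𝓡 m) 1 P := IsManifold.of_le (n := ∞) (by norm_cast)
  obtain ⟨e, he⟩ := isInvertible_mfderivWithin_extChartAt_symm (I := 𝓡 m) hy
  rw [show range (𝓡 m) = univ from ModelWithCorners.range_eq_univ _, mfderivWithin_univ] at he
  rw [← he]
  exact e.bijective

theorem mfderiv_extChartAt_symm_eq_zero_iff {q : P} {y : Euc m}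
    (hy : y ∈ (extChartAt (𝓡 m) q).target) (v : Euc m) :
    mfderiv 𝓘(ℝ, Euc m) (𝓡 m) (extChartAt (𝓡 m) q).symm y v = 0 ↔ v = 0 :=
  map_eq_zero_iff (mfderiv 𝓘(ℝ, Euc m) (𝓡 m) (extChartAt (𝓡 m) q).symm y)
    (mfderiv_extChartAt_symm_bijective hy).1

end ChartInverse

section LocalHomothety

variable {m : ℕ} {P : Type*} [TopologicalSpace P] [T2Space P]
    [ChartedSpace (Euc m) P] [IsManifold (𝓡 m) ∞ P]
    (σ : Bundle.ContMDiffRiemannianMetric (𝓡 m) ∞ (Euc m) (fun x : P => TangentSpace (𝓡 m) x))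
    {M : Type*} [EMetricSpace M] [ChartedSpace (Euc m) M] [IsManifold (𝓡 m) ∞ M]
    [RiemannianBundle (fun p : M => TangentSpace (𝓡 m) p)]
    [IsRiemannianManifold (𝓡 m) M]

/-- A local homothety can be moved along straight lines in a chart of the target at bounded cost. -/
theorem exists_edist_le_of_homothety {φ : M → P} (hφ : ContMDiff (𝓡 m) (𝓡 m) ∞ φ) {k : ℝ}
    (hiso : ∀ (p : M) (v : TangentSpace (𝓡 m) p), inner ℝ v v =
      k * σ.inner (φ p) (mfderiv (𝓡 m) (𝓡 m) φ p v) (mfderiv (𝓡 m) (𝓡 m) φ p v))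
    {x₀ : P} {q : M} (hq : φ q ∈ (extChartAt (𝓡 m) x₀).source) {e : Euc m} {C s₀ : ℝ}
    (hs₀ : 0 < s₀)
    (hmem : ∀ s ∈ Icc 0 s₀, extChartAt (𝓡 m) x₀ (φ q) + s • e ∈ (extChartAt (𝓡 m) x₀).target)
    (hC : ∀ s ∈ Icc 0 s₀, k * formInChart σ.inner x₀ (extChartAt (𝓡 m) x₀ (φ q) + s • e) e e ≤ C ^ 2)
    (hC0 : 0 ≤ C) :
    ∃ q' : M, ∃ s ∈ Ioc 0 s₀, φ q' ∈ (extChartAt (𝓡 m) x₀).source ∧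
      extChartAt (𝓡 m) x₀ (φ q') = extChartAt (𝓡 m) x₀ (φ q) + s • e ∧
      edist q q' ≤ ENNReal.ofReal (C * s) := by
  set χ := extChartAt (𝓡 m) x₀ with hχ
  set κ := extChartAt (𝓡 m) q with hκ
  set η := χ (φ q) with hη
  set y₀ := κ q with hy₀
  have hy₀t : y₀ ∈ κ.target := mem_extChartAt_target q
  have hκy₀ : κ.symm y₀ = q := extChartAt_to_inv q
  set f : Euc m → Euc m := fun y => χ (φ (κ.symm y)) with hf
  have hfy₀ : f y₀ = η := by simp only [hf, hκy₀, hη]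
  have hq' : φ q ∈ (chartAt (Euc m) x₀).source := by rwa [hχ, extChartAt_source] at hq
  have hφκ : ContMDiffAt 𝓘(ℝ, Euc m) (𝓡 m) ∞ (φ ∘ κ.symm) y₀ :=
    hφ.contMDiffAt.comp y₀ (contMDiffAt_extChartAt_symm_of_mem_target hy₀t)
  have hfs : ContDiffAt ℝ ∞ f y₀ := by
    rw [← contMDiffAt_iff_contDiffAt]
    have h1 : ContMDiffAt (𝓡 m) 𝓘(ℝ, Euc m) ∞ χ ((φ ∘ κ.symm) y₀) := by
      simp only [Function.comp, hκy₀]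
      exact contMDiffAt_extChartAt' hq'
    exact h1.comp y₀ hφκ
  have hηt : η ∈ χ.target := χ.map_source hq
  have hsrc : ∀ᶠ y in 𝓝 y₀, φ (κ.symm y) ∈ χ.source := by
    have := hφκ.continuousAt.preimage_mem_nhds (t := χ.source)
      (by simp only [Function.comp, hκy₀]; exact (isOpen_extChartAt_source x₀).mem_nhds hq)
    exact this
  -- A vector killed by `dφ` has length zero by the homothety relation, so `φ` in charts has an
  -- invertible derivative and the inverse function theorem applies.
  have hinj : Function.Injective (fderiv ℝ f y₀ : Euc m →ₗ[ℝ] Euc m) := by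
    rw [injective_iff_map_eq_zero]
    intro v hv
    have hv' : fderiv ℝ f y₀ v = 0 := hv
    have h2 : φ ∘ κ.symm =ᶠ[𝓝 y₀] χ.symm ∘ f := by
      filter_upwards [hsrc] with y hy using (χ.left_inv hy).symm
    have h1 : mfderiv (𝓡 m) (𝓡 m) φ (κ.symm y₀)
        (mfderiv 𝓘(ℝ, Euc m) (𝓡 m) κ.symm y₀ v) = 0 := by
      refine (mfderiv_mfderiv_eq_of_comp_eventuallyEq (I := 𝓘(ℝ, Euc m)) (I₁ := 𝓡 m) (I' := 𝓡 m)
        (I₂ := 𝓘(ℝ, Euc m)) h2 (hφ.mdifferentiable (by simp) _)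
        (mdifferentiableAt_extChartAt_symm_of_mem_target hy₀t)
        (by rw [hfy₀]; exact mdifferentiableAt_extChartAt_symm_of_mem_target hηt)
        (hfs.differentiableAt (by simp)).mdifferentiableAt v).trans ?_
      have h4 : mfderiv 𝓘(ℝ, Euc m) 𝓘(ℝ, Euc m) f y₀ v = 0 := by
        rw [mfderiv_eq_fderiv]; exact hv'
      exact (congrArg _ h4).trans (map_zero _)
    have h3 := hiso (κ.symm y₀) (mfderiv 𝓘(ℝ, Euc m) (𝓡 m) κ.symm y₀ v)
    rw [h1, map_zero, mul_zero] at h3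
    exact (mfderiv_extChartAt_symm_eq_zero_iff hy₀t v).1 (inner_self_eq_zero.1 h3)
  let A : Euc m ≃L[ℝ] Euc m := (LinearEquiv.ofInjectiveEndo _ hinj).toContinuousLinearEquiv
  have hA : HasFDerivAt f (A : Euc m →L[ℝ] Euc m) y₀ := (hfs.differentiableAt (by simp)).hasFDerivAt
  have hstrict : HasStrictFDerivAt f (A : Euc m →L[ℝ] Euc m) y₀ := hfs.hasStrictFDerivAt' hA (by simp)
  set G := hfs.localInverse hA (by simp) with hG
  have hGη : G η = y₀ := by rw [← hfy₀]; exact hfs.localInverse_apply_image hA (by simp)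
  have hGs : ContDiffAt ℝ ∞ G η := by rw [← hfy₀]; exact hfs.to_localInverse hA (by simp)
  have hGr : ∀ᶠ z in 𝓝 η, f (G z) = z := by
    rw [← hfy₀]; exact hstrict.eventually_right_inverse
  have hGt : Tendsto G (𝓝 η) (𝓝 y₀) := by
    have := hGs.continuousAt.tendsto; rwa [hGη] at this
  have hgood : ∀ᶠ z in 𝓝 η, ContDiffAt ℝ 1 G z ∧ f (G z) = z ∧ G z ∈ κ.target ∧
      φ (κ.symm (G z)) ∈ χ.source := by
    filter_upwards [(hGs.of_le (m := 1) (by norm_cast)).eventually (by simp), hGr,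
      hGt.eventually ((isOpen_extChartAt_target q).mem_nhds hy₀t), hGt.eventually hsrc]
      with z h1 h2 h3 h4 using ⟨h1, h2, h3, h4⟩
  set ℓ : ℝ → Euc m := fun s => η + s • e with hℓ
  have hℓc : Continuous ℓ := by fun_prop
  have hℓ0 : ℓ 0 = η := by simp [hℓ]
  have hℓd : ∀ s, HasDerivAt ℓ e s := fun s => by
    simpa [hℓ] using ((hasDerivAt_id s).smul_const e).const_add η
  have hℓgood : ∀ᶠ s in 𝓝 (0 : ℝ), ∀ᶠ z in 𝓝 (ℓ s), ContDiffAt ℝ 1 G z ∧ f (G z) = z ∧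
      G z ∈ κ.target ∧ φ (κ.symm (G z)) ∈ χ.source := by
    have h0 := hℓc.tendsto 0
    rw [hℓ0] at h0
    exact h0.eventually (eventually_eventually_nhds.2 hgood)
  obtain ⟨δ, hδ, hδgood⟩ := Metric.eventually_nhds_iff.1 hℓgood
  set s₁ := min (δ / 2) s₀ with hs₁
  have hs₁pos : 0 < s₁ := lt_min (by positivity) hs₀
  have hgoodI : ∀ s ∈ Icc 0 s₁, ∀ᶠ z in 𝓝 (ℓ s), ContDiffAt ℝ 1 G z ∧ f (G z) = z ∧
      G z ∈ κ.target ∧ φ (κ.symm (G z)) ∈ χ.source := by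
    intro s hs
    refine hδgood ?_
    rw [dist_zero_right, Real.norm_of_nonneg hs.1]
    have := hs.2.trans (min_le_left _ _)
    linarith
  -- The lift through the local inverse of the segment `ℓ`. Its squared speed is `k` times that of
  -- the segment, hence at most `C²`.
  set γ : ℝ → M := fun s => κ.symm (G (ℓ s)) with hγ
  have hγs : ∀ s ∈ Icc 0 s₁, ContMDiffAt 𝓘(ℝ, ℝ) (𝓡 m) 1 γ s := by
    intro s hs
    have h := (hgoodI s hs).self_of_nhds
    have h1 : ContMDiffAt 𝓘(ℝ, Euc m) (𝓡 m) 1 κ.symm (G (ℓ s)) :=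
      (contMDiffAt_extChartAt_symm_of_mem_target h.2.2.1).of_le (by norm_cast)
    have h2 : ContMDiffAt 𝓘(ℝ, ℝ) 𝓘(ℝ, Euc m) 1 (fun s => G (ℓ s)) s := by
      rw [contMDiffAt_iff_contDiffAt]
      have hℓs : ContDiffAt ℝ 1 ℓ s := by fun_prop
      exact h.1.comp s hℓs
    exact h1.comp s h2
  have hspeed : ∀ s ∈ Icc 0 s₁, ‖mfderiv 𝓘(ℝ, ℝ) (𝓡 m) γ s 1‖ₑ ≤ ENNReal.ofReal C := by
    intro s hs
    have hs' : s ∈ Icc 0 s₀ := ⟨hs.1, hs.2.trans (min_le_right _ _)⟩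
    have h1 : φ ∘ γ =ᶠ[𝓝 s] χ.symm ∘ ℓ := by
      filter_upwards [hℓc.continuousAt.eventually (hgoodI s hs)] with t ht
      have h2 : χ (φ (γ t)) = ℓ t := ht.2.1
      simp only [Function.comp]
      rw [← h2, χ.left_inv ht.2.2.2]
    have h2 : mfderiv (𝓡 m) (𝓡 m) φ (γ s) (mfderiv 𝓘(ℝ, ℝ) (𝓡 m) γ s 1) =
        mfderiv 𝓘(ℝ, Euc m) (𝓡 m) χ.symm (ℓ s) e := by
      refine (mfderiv_mfderiv_eq_of_comp_eventuallyEq (I := 𝓘(ℝ, ℝ)) (I₁ := 𝓡 m) (I' := 𝓡 m)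
        (I₂ := 𝓘(ℝ, Euc m)) h1 (hφ.mdifferentiable (by simp) (γ s))
        ((hγs s hs).mdifferentiableAt (by simp))
        (mdifferentiableAt_extChartAt_symm_of_mem_target (hmem s hs'))
        (hℓd s).differentiableAt.mdifferentiableAt (1 : ℝ)).trans ?_
      have h5 : mfderiv 𝓘(ℝ, ℝ) 𝓘(ℝ, Euc m) ℓ s (1 : ℝ) = e := by
        rw [mfderiv_eq_fderiv]
        exact (hℓd s).deriv
      exact congrArg _ h5
    have h3 := hiso (γ s) (mfderiv 𝓘(ℝ, ℝ) (𝓡 m) γ s 1)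
    have h6 : φ (γ s) = χ.symm (ℓ s) := h1.eq_of_nhds
    have h4 : k * σ.inner (φ (γ s))
        (mfderiv (𝓡 m) (𝓡 m) φ (γ s) (mfderiv 𝓘(ℝ, ℝ) (𝓡 m) γ s 1))
        (mfderiv (𝓡 m) (𝓡 m) φ (γ s) (mfderiv 𝓘(ℝ, ℝ) (𝓡 m) γ s 1)) =
        k * formInChart σ.inner x₀ (ℓ s) e e := by
      rw [h2, h6]; rfl
    rw [h4, real_inner_self_eq_norm_sq] at h3
    have h5 := hC s hs'
    rw [← ofReal_norm]
    refine ENNReal.ofReal_le_ofReal (abs_le_of_sq_le_sq' ?_ hC0).2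
    rw [h3]; exact h5
  have hγ0 : γ 0 = q := by simp only [hγ, hℓ0, hGη, hκy₀]
  have hend := (hgoodI s₁ ⟨hs₁pos.le, le_rfl⟩).self_of_nhds
  refine ⟨γ s₁, s₁, ⟨hs₁pos, min_le_right _ _⟩, hend.2.2.2, hend.2.1, ?_⟩
  rw [IsRiemannianManifold.out (I := 𝓡 m) q (γ s₁)]
  refine (Manifold.riemannianEDist_le_pathELength (fun s hs => (hγs s hs).contMDiffWithinAt) hγ0 rfl
    hs₁pos.le).trans ?_
  rw [Manifold.pathELength_eq_lintegral_mfderiv_Icc]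
  refine (MeasureTheory.setLIntegral_mono measurable_const hspeed).trans ?_
  rw [MeasureTheory.setLIntegral_const, Real.volume_Icc, sub_zero, ENNReal.ofReal_mul hC0]

/-- A local homothety from a complete connected Riemannian manifold to a connected Riemannian
manifold is surjective. -/
theorem surjective_of_homothety [ConnectedSpace P] [Nonempty M] [CompleteSpace M] {φ : M → P}
    (hφ : ContMDiff (𝓡 m) (𝓡 m) ∞ φ) {k : ℝ} (hk : 0 ≤ k)
    (hiso : ∀ (p : M) (v : TangentSpace (𝓡 m) p), inner ℝ v v =
      k * σ.inner (φ p) (mfderiv (𝓡 m) (𝓡 m) φ p v) (mfderiv (𝓡 m) (𝓡 m) φ p v)) :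
    Function.Surjective φ := by
  -- This local dichotomy makes both the range and its complement open.
  have hloc : ∀ x₀ : P, ∃ V ∈ 𝓝 x₀, ∀ x ∈ V, ∀ x' ∈ V, x ∈ range φ → x' ∈ range φ := by
    intro x₀
    set χ := extChartAt (𝓡 m) x₀ with hχ
    obtain ⟨R, hR, hRt⟩ := Metric.isOpen_iff.1 (isOpen_extChartAt_target (I := 𝓡 m) x₀) (χ x₀)
      (mem_extChartAt_target x₀)
    -- If the starting point and the target `ξ` lie within `r` of the centre, the start is within
    -- `2r` of `ξ`, and the `2r`-ball about `ξ` stays in the compact `3r`-ball, where the metric is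
    -- bounded.
    set r := R / 4 with hr
    have hrpos : 0 < r := by positivity
    have hKt : Metric.closedBall (χ x₀) (3 * r) ⊆ χ.target :=
      (Metric.closedBall_subset_ball (by linarith)).trans hRt
    obtain ⟨C₀, hC₀⟩ := (isCompact_closedBall (χ x₀) (3 * r)).exists_bound_of_continuousOn
      (E := Euc m →L[ℝ] Euc m →L[ℝ] ℝ) ((contDiffOn_formInChart σ.contMDiff x₀).continuousOn.mono hKt)
    have hC₀0 : 0 ≤ C₀ := (norm_nonneg _).trans
      (hC₀ (χ x₀) (Metric.mem_closedBall_self (by positivity)))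
    set C := Real.sqrt (k * C₀) with hC
    have hC2 : C ^ 2 = k * C₀ := Real.sq_sqrt (mul_nonneg hk hC₀0)
    refine ⟨χ.source ∩ χ ⁻¹' Metric.ball (χ x₀) r, ?_, ?_⟩
    · exact inter_mem (extChartAt_source_mem_nhds x₀)
        ((continuousAt_extChartAt x₀).preimage_mem_nhds (Metric.ball_mem_nhds _ hrpos))
    rintro x ⟨hxs, hxb⟩ x' ⟨hxs', hxb'⟩ ⟨p, rfl⟩
    set ξ := χ x' with hξ
    have hξ0 : dist ξ (χ x₀) < r := hxb'
    have hBK : Metric.closedBall ξ (2 * r) ⊆ Metric.closedBall (χ x₀) (3 * r) :=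
      Metric.closedBall_subset_closedBall' (by linarith)
    have hBt := hBK.trans hKt
    set A : Set M := φ ⁻¹' (χ.symm '' Metric.closedBall ξ (2 * r)) with hA
    have hAclosed : IsClosed A := by
      refine IsClosed.preimage hφ.continuous (IsCompact.isClosed ?_)
      exact (isCompact_closedBall _ _).image_of_continuousOn
        ((continuousOn_extChartAt_symm x₀).mono hBt)
    have hAmem : ∀ q, q ∈ A ↔ φ q ∈ χ.source ∧ χ (φ q) ∈ Metric.closedBall ξ (2 * r) := by
      intro q
      constructor
      · rintro ⟨y, hy, hyq⟩
        rw [← hyq]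
        exact ⟨χ.map_target (hBt hy), by rwa [χ.right_inv (hBt hy)]⟩
      · rintro ⟨h1, h2⟩
        exact ⟨_, h2, χ.left_inv h1⟩
    have hpA : p ∈ A := by
      refine (hAmem p).2 ⟨hxs, ?_⟩
      have h1 : dist (χ (φ p)) (χ x₀) < r := hxb
      have := dist_triangle_right (χ (φ p)) ξ (χ x₀)
      rw [Metric.mem_closedBall]; linarith
    have hfc : ContinuousOn (fun q => ‖χ (φ q) - ξ‖) A := by
      have h1 : ContinuousOn (fun q => χ (φ q)) A :=
        (continuousOn_extChartAt x₀).comp hφ.continuous.continuousOn fun q hq => ((hAmem q).1 hq).1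
      exact (h1.sub continuousOn_const).norm
    obtain ⟨q, hqA, hq⟩ := exists_eq_zero_of_decrease hAclosed ⟨p, hpA⟩ hfc
      (fun _ _ => norm_nonneg _) (Real.sqrt_nonneg (k * C₀)) (by
        intro q hq hpos
        obtain ⟨hqs, hqb⟩ := (hAmem q).1 hq
        set d := ‖χ (φ q) - ξ‖ with hd
        have hd2 : d ≤ 2 * r := by rwa [Metric.mem_closedBall, dist_eq_norm] at hqb
        -- The unit vector pointing towards `ξ`: moving by `s` lowers the distance to `ξ` by exactly
        -- `s`, at cost at most `C s`.
        set e : Euc m := -(d⁻¹ • (χ (φ q) - ξ)) with he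
        have hen : ‖e‖ = 1 := by
          rw [he, norm_neg, norm_smul, ← hd, norm_inv, Real.norm_of_nonneg hpos.le]
          exact inv_mul_cancel₀ hpos.ne'
        have hmove : ∀ s ∈ Icc 0 d, ‖χ (φ q) + s • e - ξ‖ = d - s := by
          intro s hs
          have h1 : χ (φ q) + s • e - ξ = (1 - s * d⁻¹) • (χ (φ q) - ξ) := by rw [he]; module
          have h2 : 0 ≤ 1 - s * d⁻¹ := by
            rw [sub_nonneg, ← div_eq_mul_inv, div_le_one hpos]; exact hs.2
          rw [h1, norm_smul, ← hd, Real.norm_of_nonneg h2]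
          field_simp
        have hmoveB : ∀ s ∈ Icc 0 d, χ (φ q) + s • e ∈ Metric.closedBall ξ (2 * r) := by
          intro s hs
          rw [Metric.mem_closedBall, dist_eq_norm, hmove s hs]
          linarith [hs.1]
        obtain ⟨q', s, hs, h1, h2, h3⟩ := exists_edist_le_of_homothety σ hφ hiso (x₀ := x₀) hqs
          hpos (e := e) (C := C) (fun s hs => hBt (hmoveB s hs)) (by
            intro s hs
            rw [hC2]
            refine mul_le_mul_of_nonneg_left ?_ hk
            refine (le_abs_self _).trans ?_
            have := (formInChart σ.inner x₀ (χ (φ q) + s • e)).le_opNorm₂ e e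
            rw [hen, mul_one, mul_one] at this
            exact this.trans (hC₀ _ (hBK (hmoveB s hs)))) (Real.sqrt_nonneg _)
        have hs' : s ∈ Icc 0 d := ⟨hs.1.le, hs.2⟩
        have h4 : ‖χ (φ q') - ξ‖ = d - s := by
          rw [← hmove s hs', ← h2]
        refine ⟨q', (hAmem q').2 ⟨h1, ?_⟩, ?_, ?_⟩
        · rw [hχ, h2]; exact hmoveB s hs'
        · rw [h4]; linarith [hs.1]
        · rw [h4, sub_sub_cancel]; exact h3)
    refine ⟨q, χ.injOn ((hAmem q).1 hqA).1 hxs' ?_⟩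
    exact sub_eq_zero.1 (norm_eq_zero.1 hq)
  rw [← range_eq_univ]
  refine IsClopen.eq_univ ⟨?_, ?_⟩ (range_nonempty φ)
  · rw [← isOpen_compl_iff, isOpen_iff_mem_nhds]
    intro x hx
    obtain ⟨V, hV, h⟩ := hloc x
    filter_upwards [hV] with x' hx' hmem using hx (h x' hx' x (mem_of_mem_nhds hV) hmem)
  · rw [isOpen_iff_mem_nhds]
    intro x hx
    obtain ⟨V, hV, h⟩ := hloc x
    filter_upwards [hV] with x' hx' using h x (mem_of_mem_nhds hV) x' hx' hx

end LocalHomothety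

/-! ### The spacetime metric and the immersion read in charts. -/

namespace DoublyWarpedProduct

section ProductChart

variable {m : ℕ} {P : Type*} [TopologicalSpace P] [ChartedSpace (Euc m) P]
  [IsManifold (𝓡 m) ∞ P] (D : DoublyWarpedProduct m P)

/-- The metric of a doubly warped product, read in the preferred chart at `q`. -/
def chartForm (q : ℝ × P) : ℝ × Euc m → (ℝ × Euc m) →L[ℝ] (ℝ × Euc m) →L[ℝ] ℝ :=
  warpedForm (fun x => D.h ((extChartAt (𝓡 m) q.2).symm x)) D.ρ (formInChart D.σ.inner q.2)

theorem extChartAt_prodModel_symm_apply (q : ℝ × P) (x : ℝ × Euc m) :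
    (extChartAt (prodModel m) q).symm x = (x.1, (extChartAt (𝓡 m) q.2).symm x.2) := by
  rw [extChartAt_prod]
  rfl

theorem extChartAt_prodModel_apply (q q' : ℝ × P) :
    extChartAt (prodModel m) q q' = (q'.1, extChartAt (𝓡 m) q.2 q'.2) := by
  rw [extChartAt_prod]
  rfl

theorem mfderiv_extChartAt_prodModel_symm {q : ℝ × P} {x : ℝ × Euc m}
    (hx : x.2 ∈ (extChartAt (𝓡 m) q.2).target) (u : ℝ × Euc m) :
    @Eq (ℝ × Euc m)
      (mfderiv 𝓘(ℝ, ℝ × Euc m) (prodModel m) (extChartAt (prodModel m) q).symm x u)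
      (u.1, mfderiv 𝓘(ℝ, Euc m) (𝓡 m) (extChartAt (𝓡 m) q.2).symm x.2 u.2) := by
  have h0 : ⇑(extChartAt (prodModel m) q).symm =
      fun x : ℝ × Euc m => (x.1, (extChartAt (𝓡 m) q.2).symm x.2) := by
    funext x; exact extChartAt_prodModel_symm_apply q x
  have h1 : MDifferentiableAt 𝓘(ℝ, ℝ × Euc m) 𝓘(ℝ, ℝ) (fun x : ℝ × Euc m => x.1) x :=
    differentiableAt_fst.mdifferentiableAt
  have h2 : MDifferentiableAt 𝓘(ℝ, ℝ × Euc m) 𝓘(ℝ, Euc m) (fun x : ℝ × Euc m => x.2) x :=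
    differentiableAt_snd.mdifferentiableAt
  have h3 := mdifferentiableAt_extChartAt_symm_of_mem_target hx
  have h4 : MDifferentiableAt 𝓘(ℝ, ℝ × Euc m) (𝓡 m)
      (fun x : ℝ × Euc m => (extChartAt (𝓡 m) q.2).symm x.2) x := h3.comp x h2
  have h5 := mfderiv_prodMk h1 h4
  rw [h0]
  refine (congrArg (fun L : (ℝ × Euc m) →L[ℝ] (ℝ × Euc m) => L u) h5).trans ?_
  refine Prod.ext ?_ ?_
  · change mfderiv 𝓘(ℝ, ℝ × Euc m) 𝓘(ℝ, ℝ) (fun x : ℝ × Euc m => x.1) x u = u.1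
    rw [mfderiv_eq_fderiv, fderiv_fst]; rfl
  · change mfderiv 𝓘(ℝ, ℝ × Euc m) (𝓡 m)
      (fun x : ℝ × Euc m => (extChartAt (𝓡 m) q.2).symm x.2) x u = _
    refine (mfderiv_comp_apply x h3 h2 u).trans ?_
    refine congrArg _ ?_
    rw [mfderiv_eq_fderiv, fderiv_snd]; rfl

/-- All tangent spaces are the same model space, so vectors at equal base points are compared there
without transport. -/
theorem metric_congr {q q' : ℝ × P} (h : q = q') {u v u' v' : ℝ × Euc m} (hu : u = u')
    (hv : v = v') : D.metric q u v = D.metric q' u' v' := by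
  subst h hu hv; rfl

theorem metricInChart_metric {q : ℝ × P} {x : ℝ × Euc m}
    (hx : x.2 ∈ (extChartAt (𝓡 m) q.2).target) (u v : ℝ × Euc m) :
    metricInChart (prodModel m) D.metric q u v x = D.chartForm q x u v := by
  rw [chartForm, warpedForm_apply]
  exact D.metric_congr (extChartAt_prodModel_symm_apply q x)
    (mfderiv_extChartAt_prodModel_symm hx u) (mfderiv_extChartAt_prodModel_symm hx v)

theorem christoffelFirst_metric (q : ℝ × P) (u v w : ℝ × Euc m) :
    christoffelFirst (prodModel m) D.metric q u v w =
      flatChristoffel (fun x u v => D.chartForm q x u v) (extChartAt (prodModel m) q q) u v w := by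
  refine flatChristoffel_congr (b := fun y u v => metricInChart (prodModel m) D.metric q u v y)
    ?_ u v w
  have h1 : (extChartAt (prodModel m) q q).2 ∈ (extChartAt (𝓡 m) q.2).target := by
    rw [extChartAt_prodModel_apply]; exact mem_extChartAt_target q.2
  filter_upwards [continuousAt_snd.preimage_mem_nhds
    ((isOpen_extChartAt_target q.2).mem_nhds h1)] with x hx u v using D.metricInChart_metric hx u v

/-- Tangent vectors at `p` are by convention their coordinates in the preferred chart at `p`. This
is why coordinate second derivatives and tangent vectors may be mixed in the second fundamental
form. -/
theorem mfderiv_extChartAt_symm_self (p : P) (v : Euc m) :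
    @Eq (Euc m) (mfderiv 𝓘(ℝ, Euc m) (𝓡 m) (extChartAt (𝓡 m) p).symm (extChartAt (𝓡 m) p p) v)
      v := by
  have : IsManifold (𝓡 m) 1 P := IsManifold.of_le (n := ∞) (by norm_cast)
  have h := mfderivWithin_range_extChartAt_symm (I := 𝓡 m) (x := p)
  rw [show range (𝓡 m) = univ from ModelWithCorners.range_eq_univ _, mfderivWithin_univ] at h
  exact congrArg (fun L : Euc m →L[ℝ] Euc m => L v) h

theorem chartForm_self (q : ℝ × P) (u v : ℝ × Euc m) :
    D.chartForm q (extChartAt (prodModel m) q q) u v = D.metric q u v := by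
  have h1 : (extChartAt (prodModel m) q q).2 ∈ (extChartAt (𝓡 m) q.2).target := by
    rw [extChartAt_prodModel_apply]; exact mem_extChartAt_target q.2
  have h2 : ∀ u : ℝ × Euc m, @Eq (ℝ × Euc m) (mfderiv 𝓘(ℝ, ℝ × Euc m) (prodModel m)
      (extChartAt (prodModel m) q).symm (extChartAt (prodModel m) q q) u) u := fun u => by
    refine (mfderiv_extChartAt_prodModel_symm h1 u).trans (Prod.ext rfl ?_)
    have h3 : (extChartAt (prodModel m) q q).2 = extChartAt (𝓡 m) q.2 q.2 := by
      rw [extChartAt_prodModel_apply]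
    change mfderiv 𝓘(ℝ, Euc m) (𝓡 m) (extChartAt (𝓡 m) q.2).symm
      (extChartAt (prodModel m) q q).2 u.2 = u.2
    rw [h3]
    exact mfderiv_extChartAt_symm_self q.2 u.2
  rw [← D.metricInChart_metric h1]
  exact D.metric_congr (extChartAt_to_inv q) (h2 u) (h2 v)

end ProductChart

section Hypersurface

variable {m : ℕ} {P : Type*} [TopologicalSpace P] [ChartedSpace (Euc m) P]
  [IsManifold (𝓡 m) ∞ P] (D : DoublyWarpedProduct m P)
  {M : Type*} [TopologicalSpace M] [ChartedSpace (Euc m) M] [IsManifold (𝓡 m) ∞ M]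

/-- The map `ψ` read in the preferred charts at `p₀` and at `q`. -/
def chartMap (ψ : M → ℝ × P) (p₀ : M) (q : ℝ × P) (z : Euc m) : ℝ × Euc m :=
  extChartAt (prodModel m) q (ψ ((extChartAt (𝓡 m) p₀).symm z))

variable {ψ : M → ℝ × P} {p₀ : M} {y : Euc m}

theorem contDiffAt_chartMap (hψ : ContMDiff (𝓡 m) (prodModel m) ∞ ψ)
    (hy : y ∈ (extChartAt (𝓡 m) p₀).target) {q : ℝ × P}
    (hq : (ψ ((extChartAt (𝓡 m) p₀).symm y)).2 ∈ (extChartAt (𝓡 m) q.2).source) :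
    ContDiffAt ℝ ∞ (chartMap ψ p₀ q) y := by
  rw [← contMDiffAt_iff_contDiffAt]
  have h1 : ContMDiffAt (prodModel m) 𝓘(ℝ, ℝ × Euc m) ∞ (extChartAt (prodModel m) q)
      (ψ ((extChartAt (𝓡 m) p₀).symm y)) := by
    refine contMDiffAt_extChartAt' ?_
    rw [← extChartAt_source (prodModel m), extChartAt_prod]
    exact ⟨by rw [extChartAt_model_space_eq_id]; exact mem_univ _, hq⟩
  exact h1.comp y (hψ.contMDiffAt.comp y (contMDiffAt_extChartAt_symm_of_mem_target hy))

theorem eventually_mem_source (hψ : ContMDiff (𝓡 m) (prodModel m) ∞ ψ)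
    (hy : y ∈ (extChartAt (𝓡 m) p₀).target) {q : ℝ × P}
    (hq : (ψ ((extChartAt (𝓡 m) p₀).symm y)).2 ∈ (extChartAt (𝓡 m) q.2).source) :
    ∀ᶠ z in 𝓝 y, z ∈ (extChartAt (𝓡 m) p₀).target ∧
      (ψ ((extChartAt (𝓡 m) p₀).symm z)).2 ∈ (extChartAt (𝓡 m) q.2).source := by
  have h1 : ContinuousAt (fun z => (ψ ((extChartAt (𝓡 m) p₀).symm z)).2) y :=
    continuousAt_snd.comp (hψ.continuous.continuousAt.comp
      (contMDiffAt_extChartAt_symm_of_mem_target hy).continuousAt)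
  filter_upwards [(isOpen_extChartAt_target p₀).mem_nhds hy,
    h1.preimage_mem_nhds ((isOpen_extChartAt_source q.2).mem_nhds hq)] with z h2 h3 using ⟨h2, h3⟩

theorem extChartAt_prodModel_symm_chartMap {q : ℝ × P}
    (hq : (ψ ((extChartAt (𝓡 m) p₀).symm y)).2 ∈ (extChartAt (𝓡 m) q.2).source) :
    (extChartAt (prodModel m) q).symm (chartMap ψ p₀ q y) = ψ ((extChartAt (𝓡 m) p₀).symm y) := by
  rw [chartMap, extChartAt_prodModel_apply, extChartAt_prodModel_symm_apply]
  simp only [(extChartAt (𝓡 m) q.2).left_inv hq]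

theorem chartMap_snd_mem_target {q : ℝ × P}
    (hq : (ψ ((extChartAt (𝓡 m) p₀).symm y)).2 ∈ (extChartAt (𝓡 m) q.2).source) :
    (chartMap ψ p₀ q y).2 ∈ (extChartAt (𝓡 m) q.2).target := by
  rw [chartMap, extChartAt_prodModel_apply]
  exact (extChartAt (𝓡 m) q.2).map_source hq

/-- The pullback by `ψ` of the metric of the spacetime, computed in charts. -/
theorem metric_mfderiv_eq_chartForm (hψ : ContMDiff (𝓡 m) (prodModel m) ∞ ψ)
    (hy : y ∈ (extChartAt (𝓡 m) p₀).target) {q : ℝ × P}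
    (hq : (ψ ((extChartAt (𝓡 m) p₀).symm y)).2 ∈ (extChartAt (𝓡 m) q.2).source) (a b : Euc m) :
    D.metric (ψ ((extChartAt (𝓡 m) p₀).symm y))
        (mfderiv (𝓡 m) (prodModel m) ψ ((extChartAt (𝓡 m) p₀).symm y)
          (mfderiv 𝓘(ℝ, Euc m) (𝓡 m) (extChartAt (𝓡 m) p₀).symm y a))
        (mfderiv (𝓡 m) (prodModel m) ψ ((extChartAt (𝓡 m) p₀).symm y)
          (mfderiv 𝓘(ℝ, Euc m) (𝓡 m) (extChartAt (𝓡 m) p₀).symm y b)) =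
      D.chartForm q (chartMap ψ p₀ q y) (fderiv ℝ (chartMap ψ p₀ q) y a)
        (fderiv ℝ (chartMap ψ p₀ q) y b) := by
  have hev : ψ ∘ (extChartAt (𝓡 m) p₀).symm =ᶠ[𝓝 y]
      (extChartAt (prodModel m) q).symm ∘ chartMap ψ p₀ q := by
    filter_upwards [eventually_mem_source hψ hy hq] with z hz
    exact (extChartAt_prodModel_symm_chartMap hz.2).symm
  have ht := chartMap_snd_mem_target hq
  have hsd : MDifferentiableAt 𝓘(ℝ, ℝ × Euc m) (prodModel m) (extChartAt (prodModel m) q).symm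
      (chartMap ψ p₀ q y) := by
    have : chartMap ψ p₀ q y ∈ (extChartAt (prodModel m) q).target := by
      rw [extChartAt_prod]
      exact ⟨by rw [extChartAt_model_space_eq_id]; exact mem_univ _, ht⟩
    exact ((contMDiffOn_extChartAt_symm (I := prodModel m) (n := ∞) q).contMDiffAt
      ((isOpen_extChartAt_target q).mem_nhds this)).mdifferentiableAt (by simp)
  have hW := contDiffAt_chartMap hψ hy hq
  have key : ∀ a : Euc m, @Eq (ℝ × Euc m)
      (mfderiv (𝓡 m) (prodModel m) ψ ((extChartAt (𝓡 m) p₀).symm y)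
          (mfderiv 𝓘(ℝ, Euc m) (𝓡 m) (extChartAt (𝓡 m) p₀).symm y a))
      (mfderiv 𝓘(ℝ, ℝ × Euc m) (prodModel m) (extChartAt (prodModel m) q).symm
        (chartMap ψ p₀ q y) (fderiv ℝ (chartMap ψ p₀ q) y a)) := by
    intro a
    refine (mfderiv_mfderiv_eq_of_comp_eventuallyEq (I := 𝓘(ℝ, Euc m)) (I₁ := 𝓡 m)
      (I' := prodModel m) (I₂ := 𝓘(ℝ, ℝ × Euc m)) hev (hψ.mdifferentiable (by simp) _)
      (mdifferentiableAt_extChartAt_symm_of_mem_target hy) hsd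
      (hW.differentiableAt (by simp)).mdifferentiableAt a).trans ?_
    rw [mfderiv_eq_fderiv]
    rfl
  rw [← D.metricInChart_metric ht]
  exact D.metric_congr (extChartAt_prodModel_symm_chartMap hq).symm (key a) (key b)

end Hypersurface

end DoublyWarpedProduct

/-! ### Change of chart on the hypersurface. -/

namespace DoublyWarpedProduct

variable {m : ℕ} {P : Type*} [TopologicalSpace P] [ChartedSpace (Euc m) P]
  [IsManifold (𝓡 m) ∞ P] (D : DoublyWarpedProduct m P)
  {M : Type*} [TopologicalSpace M] [ChartedSpace (Euc m) M] [IsManifold (𝓡 m) ∞ M]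

/-- The transition map from the preferred chart at `p` to the preferred chart at `p₀`. -/
def transition (p₀ p : M) (z : Euc m) : Euc m :=
  extChartAt (𝓡 m) p₀ ((extChartAt (𝓡 m) p).symm z)

variable {p₀ p : M}

theorem eventually_extChartAt_symm_transition (hp : p ∈ (extChartAt (𝓡 m) p₀).source) :
    ∀ᶠ z in 𝓝 (extChartAt (𝓡 m) p p),
      (extChartAt (𝓡 m) p₀).symm (transition p₀ p z) = (extChartAt (𝓡 m) p).symm z := by
  have h1 : ContinuousAt (extChartAt (𝓡 m) p).symm (extChartAt (𝓡 m) p p) :=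
    (contMDiffAt_extChartAt_symm_of_mem_target (mem_extChartAt_target p)).continuousAt
  have h2 := (isOpen_extChartAt_source (I := 𝓡 m) p₀).mem_nhds hp
  rw [← extChartAt_to_inv (I := 𝓡 m) p] at h2
  filter_upwards [h1.preimage_mem_nhds h2] with z hz using (extChartAt (𝓡 m) p₀).left_inv hz

theorem contDiffAt_transition (hp : p ∈ (extChartAt (𝓡 m) p₀).source) :
    ContDiffAt ℝ ∞ (transition p₀ p) (extChartAt (𝓡 m) p p) := by
  rw [← contMDiffAt_iff_contDiffAt]
  have h1 : ContMDiffAt (𝓡 m) 𝓘(ℝ, Euc m) ∞ (extChartAt (𝓡 m) p₀)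
      ((extChartAt (𝓡 m) p).symm (extChartAt (𝓡 m) p p)) := by
    rw [extChartAt_to_inv]
    refine contMDiffAt_extChartAt' ?_
    rwa [← extChartAt_source (𝓡 m)]
  exact h1.comp _ (contMDiffAt_extChartAt_symm_of_mem_target (mem_extChartAt_target p))

theorem transition_self (p₀ p : M) :
    transition p₀ p (extChartAt (𝓡 m) p p) = extChartAt (𝓡 m) p₀ p := by
  rw [transition, extChartAt_to_inv]

theorem mfderiv_symm_fderiv_transition (hp : p ∈ (extChartAt (𝓡 m) p₀).source) (v : Euc m) :
    @Eq (Euc m) (mfderiv 𝓘(ℝ, Euc m) (𝓡 m) (extChartAt (𝓡 m) p₀).symm (extChartAt (𝓡 m) p₀ p)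
      (fderiv ℝ (transition p₀ p) (extChartAt (𝓡 m) p p) v)) v := by
  have hev : (extChartAt (𝓡 m) p₀).symm ∘ transition p₀ p =ᶠ[𝓝 (extChartAt (𝓡 m) p p)]
      (extChartAt (𝓡 m) p).symm ∘ id := eventually_extChartAt_symm_transition hp
  have h1 := mfderiv_mfderiv_eq_of_comp_eventuallyEq (I := 𝓘(ℝ, Euc m)) (I₁ := 𝓘(ℝ, Euc m))
    (I' := 𝓡 m) (I₂ := 𝓘(ℝ, Euc m)) hev
    (by rw [transition_self]
        exact mdifferentiableAt_extChartAt_symm_of_mem_target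
          ((extChartAt (𝓡 m) p₀).map_source hp))
    ((contDiffAt_transition hp).differentiableAt (by simp)).mdifferentiableAt
    (mdifferentiableAt_extChartAt_symm_of_mem_target (mem_extChartAt_target p))
    mdifferentiableAt_id v
  rw [mfderiv_eq_fderiv, mfderiv_id, transition_self] at h1
  exact h1.trans (mfderiv_extChartAt_symm_self p v)

section Immersion

variable {ψ : M → ℝ × P}

/-- The second fundamental form at `p` uses the chart at `p`, while the maximum principle needs one
chart for all nearby `p`; the transition map bridges the two. -/
theorem writtenInExtChartAt_eventuallyEq (hp : p ∈ (extChartAt (𝓡 m) p₀).source) :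
    writtenInExtChartAt (𝓡 m) (prodModel m) p ψ =ᶠ[𝓝 (extChartAt (𝓡 m) p p)]
      chartMap ψ p₀ (ψ p) ∘ transition p₀ p := by
  filter_upwards [eventually_extChartAt_symm_transition hp] with z hz
  simp only [writtenInExtChartAt, Function.comp, chartMap, hz]

theorem contDiffAt_chartMap_self (hψ : ContMDiff (𝓡 m) (prodModel m) ∞ ψ)
    (hp : p ∈ (extChartAt (𝓡 m) p₀).source) :
    ContDiffAt ℝ ∞ (chartMap ψ p₀ (ψ p)) (extChartAt (𝓡 m) p₀ p) := by
  refine contDiffAt_chartMap hψ ((extChartAt (𝓡 m) p₀).map_source hp) ?_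
  rw [(extChartAt (𝓡 m) p₀).left_inv hp]
  exact mem_extChartAt_source (ψ p).2

theorem mfderiv_eq_fderiv_chartMap (hψ : ContMDiff (𝓡 m) (prodModel m) ∞ ψ)
    (hp : p ∈ (extChartAt (𝓡 m) p₀).source) (v : Euc m) :
    @Eq (ℝ × Euc m) (mfderiv (𝓡 m) (prodModel m) ψ p v)
      (fderiv ℝ (chartMap ψ p₀ (ψ p)) (extChartAt (𝓡 m) p₀ p)
        (fderiv ℝ (transition p₀ p) (extChartAt (𝓡 m) p p) v)) := by
  have h1 := (hψ.mdifferentiable (by simp) p).mfderiv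
  rw [show range (𝓡 m) = univ from ModelWithCorners.range_eq_univ _, fderivWithin_univ,
    (writtenInExtChartAt_eventuallyEq hp).fderiv_eq, fderiv_comp, transition_self] at h1
  · exact congrArg (fun L : Euc m →L[ℝ] ℝ × Euc m => L v) h1
  · rw [transition_self]
    exact (contDiffAt_chartMap_self hψ hp).differentiableAt (by simp)
  · exact (contDiffAt_transition hp).differentiableAt (by simp)

/-- The correction `c` is the second derivative of the transition map. Only its existence matters,
since its image is tangent to the hypersurface. -/
theorem secondDerivInChart_eq (hψ : ContMDiff (𝓡 m) (prodModel m) ∞ ψ)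
    (hp : p ∈ (extChartAt (𝓡 m) p₀).source) (v w : Euc m) :
    ∃ c : Euc m, @Eq (ℝ × Euc m) (secondDerivInChart (𝓡 m) (prodModel m) ψ p v w)
      (fderiv ℝ (fun z => fderiv ℝ (chartMap ψ p₀ (ψ p)) z
          (fderiv ℝ (transition p₀ p) (extChartAt (𝓡 m) p p) w)) (extChartAt (𝓡 m) p₀ p)
          (fderiv ℝ (transition p₀ p) (extChartAt (𝓡 m) p p) v)
        + fderiv ℝ (chartMap ψ p₀ (ψ p)) (extChartAt (𝓡 m) p₀ p) c) := by
  have hev : (fun y => fderiv ℝ (writtenInExtChartAt (𝓡 m) (prodModel m) p ψ) y w)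
      =ᶠ[𝓝 (extChartAt (𝓡 m) p p)]
      fun y => fderiv ℝ (chartMap ψ p₀ (ψ p) ∘ transition p₀ p) y w := by
    filter_upwards [(writtenInExtChartAt_eventuallyEq (ψ := ψ) hp).fderiv (𝕜 := ℝ)] with z hz
    rw [hz]
  have h1 := fderiv_fderiv_comp_apply (f := chartMap ψ p₀ (ψ p)) (k := transition p₀ p)
    (x := extChartAt (𝓡 m) p p)
    (by rw [transition_self]; exact (contDiffAt_chartMap_self hψ hp).of_le (by norm_cast))
    ((contDiffAt_transition hp).of_le (by norm_cast)) v w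
  rw [transition_self, ← hev.fderiv_eq] at h1
  exact ⟨_, h1⟩

end Immersion

end DoublyWarpedProduct

/-! ### The second fundamental form and the Hessian inequality in a fixed chart of the hypersurface.
-/

namespace DoublyWarpedProduct

variable {m : ℕ} {P : Type*} [TopologicalSpace P] [ChartedSpace (Euc m) P]
  [IsManifold (𝓡 m) ∞ P] (D : DoublyWarpedProduct m P)
  {M : Type*} [TopologicalSpace M] [ChartedSpace (Euc m) M] [IsManifold (𝓡 m) ∞ M]
  {p₀ p : M} {ψ : M → ℝ × P}

/-- The Hessian inequality, in an orthonormal frame of the chart at `p₀`, satisfied at a point by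
the time function `ψ.1` of a spacelike immersion whose mean curvature is at least that of the
slices. Here `G` is the metric of `M` in the chart and `u`, `b` are the functions `ψ.1` and
`h ∘ ψ.2` in the chart. -/
def IsTimeSubsolutionAt (G : Euc m → Euc m →L[ℝ] Euc m →L[ℝ] ℝ) (u b : Euc m → ℝ) (y : Euc m)
    (a : Fin m → Euc m) : Prop :=
  (∀ i, G y (a i) (a i) = 1) ∧ (∀ z, z = ∑ i, G y z (a i) • a i) ∧
  0 ≤ ∑ i, (fderiv ℝ (fun z => fderiv ℝ u z (a i)) y (a i)
      - flatChristoffel (fun z v w => G z v w) y (a i) (a i) (∑ j, fderiv ℝ u y (a j) • a j)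
      + 2 / b y * fderiv ℝ b y (a i) * fderiv ℝ u y (a i)
      + deriv D.ρ (u y) / D.ρ (u y) * fderiv ℝ u y (a i) ^ 2)

theorem chartMap_fst (q : ℝ × P) (z : Euc m) :
    (chartMap ψ p₀ q z).1 = (ψ ((extChartAt (𝓡 m) p₀).symm z)).1 := by
  rw [chartMap, extChartAt_prodModel_apply]

theorem chartMap_snd (q : ℝ × P) (z : Euc m) :
    (chartMap ψ p₀ q z).2 = extChartAt (𝓡 m) q.2 (ψ ((extChartAt (𝓡 m) p₀).symm z)).2 := by
  rw [chartMap, extChartAt_prodModel_apply]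

theorem chartMap_self (hp : p ∈ (extChartAt (𝓡 m) p₀).source) :
    chartMap ψ p₀ (ψ p) (extChartAt (𝓡 m) p₀ p) = extChartAt (prodModel m) (ψ p) (ψ p) := by
  rw [chartMap, (extChartAt (𝓡 m) p₀).left_inv hp]

variable [RiemannianBundle (fun p : M => TangentSpace (𝓡 m) p)]
  {g : ∀ x : M, TangentSpace (𝓡 m) x →L[ℝ] TangentSpace (𝓡 m) x →L[ℝ] ℝ}

/-- The isometry condition in charts. It is needed on a neighbourhood, not just at the point,
because the Christoffel symbols differentiate it. -/
theorem formInChart_eq_chartForm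
    (hg : ∀ (x : M) (v w : TangentSpace (𝓡 m) x), inner ℝ v w = g x v w)
    (hψ : D.IsSpacelikeImmersion ψ) (hp : p ∈ (extChartAt (𝓡 m) p₀).source) :
    ∀ᶠ z in 𝓝 (extChartAt (𝓡 m) p₀ p), ∀ a b : Euc m, formInChart g p₀ z a b =
      D.chartForm (ψ p) (chartMap ψ p₀ (ψ p) z) (fderiv ℝ (chartMap ψ p₀ (ψ p)) z a)
        (fderiv ℝ (chartMap ψ p₀ (ψ p)) z b) := by
  filter_upwards [eventually_mem_source hψ.contMDiff ((extChartAt (𝓡 m) p₀).map_source hp)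
    (q := ψ p) (by rw [(extChartAt (𝓡 m) p₀).left_inv hp]; exact mem_extChartAt_source (ψ p).2)]
    with z hz a b
  rw [← D.metric_mfderiv_eq_chartForm hψ.contMDiff hz.1 hz.2, ← hψ.isometric, hg]
  rfl

/-- The second fundamental form paired with a normal vector, computed in the chart at `p₀`. -/
theorem secondFundamentalForm_eq (hψ : D.IsSpacelikeImmersion ψ)
    (hp : p ∈ (extChartAt (𝓡 m) p₀).source) {n : ℝ × Euc m}
    (hn : ∀ v, D.chartForm (ψ p) (chartMap ψ p₀ (ψ p) (extChartAt (𝓡 m) p₀ p)) n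
      (fderiv ℝ (chartMap ψ p₀ (ψ p)) (extChartAt (𝓡 m) p₀ p) v) = 0) (e a : Euc m)
    (ha : a = fderiv ℝ (transition p₀ p) (extChartAt (𝓡 m) p p) e) :
    secondFundamentalForm (𝓡 m) (prodModel m) D.metric ψ p n e e =
      D.chartForm (ψ p) (chartMap ψ p₀ (ψ p) (extChartAt (𝓡 m) p₀ p))
        (fderiv ℝ (fun z => fderiv ℝ (chartMap ψ p₀ (ψ p)) z a) (extChartAt (𝓡 m) p₀ p) a) n
      + flatChristoffel (fun x u v => D.chartForm (ψ p) x u v)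
          (chartMap ψ p₀ (ψ p) (extChartAt (𝓡 m) p₀ p))
          (fderiv ℝ (chartMap ψ p₀ (ψ p)) (extChartAt (𝓡 m) p₀ p) a)
          (fderiv ℝ (chartMap ψ p₀ (ψ p)) (extChartAt (𝓡 m) p₀ p) a) n := by
  obtain ⟨c, hc⟩ := secondDerivInChart_eq hψ.contMDiff hp e e
  have h1 := mfderiv_eq_fderiv_chartMap hψ.contMDiff hp e
  rw [← ha] at hc h1
  have hsymm : ∀ q x u v, D.chartForm q x u v = D.chartForm q x v u := by
    intro q x u v
    rw [chartForm, warpedForm_apply, warpedForm_apply, mul_comm u.1]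
    congr 2
    exact D.σ.symm _ _ _
  unfold secondFundamentalForm
  refine congrArg₂ (· + ·) ?_ ?_
  · refine (D.metric_congr rfl hc rfl).trans ?_
    rw [← D.chartForm_self, ← chartMap_self hp, map_add, add_apply, hsymm _ _ _ n,
      hsymm _ _ (fderiv ℝ _ _ c) n, hn, add_zero, hsymm]
  · refine (congrArg (fun v : ℝ × Euc m =>
      christoffelFirst (prodModel m) D.metric (ψ p) v v n) h1).trans ?_
    rw [D.christoffelFirst_metric, ← chartMap_self hp]

end DoublyWarpedProduct

namespace DoublyWarpedProduct

variable {m : ℕ} {P : Type*} [TopologicalSpace P] [ChartedSpace (Euc m) P]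
  [IsManifold (𝓡 m) ∞ P] (D : DoublyWarpedProduct m P)
  {M : Type*} [TopologicalSpace M] [ChartedSpace (Euc m) M] [IsManifold (𝓡 m) ∞ M]
  {p₀ p : M} {ψ : M → ℝ × P}

/-- An orthonormal frame at `p`, read in the chart at `p₀`. -/
theorem exists_orthonormal_frame_inChart
    [RiemannianBundle (fun p : M => TangentSpace (𝓡 m) p)]
    {g : ∀ x : M, TangentSpace (𝓡 m) x →L[ℝ] TangentSpace (𝓡 m) x →L[ℝ] ℝ}
    (hg : ∀ (x : M) (v w : TangentSpace (𝓡 m) x), inner ℝ v w = g x v w)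
    (hp : p ∈ (extChartAt (𝓡 m) p₀).source) :
    ∃ (e : Fin (Module.finrank ℝ (TangentSpace (𝓡 m) p)) ≃ Fin m) (a : Fin m → Euc m),
      (∀ i, a (e i) = fderiv ℝ (transition p₀ p) (extChartAt (𝓡 m) p p)
        (stdOrthonormalBasis ℝ (TangentSpace (𝓡 m) p) i)) ∧
      (∀ i, formInChart g p₀ (extChartAt (𝓡 m) p₀ p) (a i) (a i) = 1) ∧
      (∀ z, z = ∑ i, formInChart g p₀ (extChartAt (𝓡 m) p₀ p) z (a i) • a i) := by
  have hdim : Module.finrank ℝ (TangentSpace (𝓡 m) p) = m := finrank_euclideanSpace_fin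
  let e := finCongr hdim
  let B := stdOrthonormalBasis ℝ (TangentSpace (𝓡 m) p)
  let T : Euc m →L[ℝ] Euc m := fderiv ℝ (transition p₀ p) (extChartAt (𝓡 m) p p)
  let S : Euc m →L[ℝ] Euc m := mfderiv 𝓘(ℝ, Euc m) (𝓡 m) (extChartAt (𝓡 m) p₀).symm
    (extChartAt (𝓡 m) p₀ p)
  let S' : Euc m → TangentSpace (𝓡 m) p := fun v => S v
  have hST : ∀ v, S (T v) = v := mfderiv_symm_fderiv_transition hp
  have hTS : ∀ v, T (S v) = v := by
    intro v
    have hinj : Function.Injective S :=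
      (mfderiv_extChartAt_symm_bijective ((extChartAt (𝓡 m) p₀).map_source hp)).1
    exact hinj (hST (S v))
  have hG : ∀ v w, formInChart g p₀ (extChartAt (𝓡 m) p₀ p) v w =
      inner ℝ (S' v) (S' w) := by
    intro v w
    have key : ∀ p' : M, p' = p → ∀ v w : Euc m,
        (show Euc m →L[ℝ] Euc m →L[ℝ] ℝ from g p') v w =
        inner ℝ (show TangentSpace (𝓡 m) p from v) (show TangentSpace (𝓡 m) p from w) := by
      rintro p' rfl v w
      exact (hg _ _ _).symm
    exact key _ ((extChartAt (𝓡 m) p₀).left_inv hp) (S v) (S w)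
  have hB : ∀ i, S' (T (B i)) = B i := fun i => hST _
  refine ⟨e, fun i => T (B (e.symm i)), fun i => by simp only [e.symm_apply_apply]; rfl,
    fun i => ?_, fun z => ?_⟩
  · rw [hG, hB]
    exact B.inner_eq_one _
  · have h1 := B.sum_repr (S' z)
    have h2 : z = ∑ j, B.repr (S' z) j • T (B j) := by
      rw [← hTS z]
      refine (congrArg T h1.symm).trans ?_
      refine (map_sum T _ _).trans ?_
      rw [hTS]
      exact Finset.sum_congr rfl fun j _ => map_smul T _ _
    refine h2.trans ?_
    rw [← Equiv.sum_comp e]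
    refine Finset.sum_congr rfl fun j _ => ?_
    dsimp only
    rw [e.symm_apply_apply, hG, hB, B.repr_apply_apply, real_inner_comm]

set_option maxHeartbeats 1000000 in
/-- A spacelike immersion with mean curvature at least that of the slices satisfies the Hessian
inequality for its time function. -/
theorem exists_isTimeSubsolutionAt
    [RiemannianBundle (fun p : M => TangentSpace (𝓡 m) p)]
    {g : ∀ x : M, TangentSpace (𝓡 m) x →L[ℝ] TangentSpace (𝓡 m) x →L[ℝ] ℝ}
    (hg : ∀ (x : M) (v w : TangentSpace (𝓡 m) x), inner ℝ v w = g x v w)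
    (hψ : D.IsSpacelikeImmersion ψ) (hp : p ∈ (extChartAt (𝓡 m) p₀).source)
    (hρ : 0 ≤ deriv D.ρ (ψ p).1) (hH : D.sliceMeanCurvature (ψ p) ≤ D.meanCurvature ψ p) :
    ∃ a : Fin m → Euc m, D.IsTimeSubsolutionAt (formInChart g p₀)
      (fun z => (ψ ((extChartAt (𝓡 m) p₀).symm z)).1)
      (fun z => D.h (ψ ((extChartAt (𝓡 m) p₀).symm z)).2) (extChartAt (𝓡 m) p₀ p) a := by
  obtain ⟨e, a, hea, ha1, ha2⟩ := exists_orthonormal_frame_inChart hg hp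
  refine ⟨a, ha1, ha2, ?_⟩
  set y := extChartAt (𝓡 m) p₀ p with hy
  set W : Euc m → ℝ × Euc m := chartMap ψ p₀ (ψ p) with hWdef
  have hW : ContDiffAt ℝ ∞ W y := contDiffAt_chartMap_self hψ.contMDiff hp
  have hsymmy : (extChartAt (𝓡 m) p₀).symm y = p := (extChartAt (𝓡 m) p₀).left_inv hp
  have hev := D.formInChart_eq_chartForm hg hψ hp
  have hGW : ∀ a b, formInChart g p₀ y a b = D.chartForm (ψ p) (W y) (fderiv ℝ W y a)
      (fderiv ℝ W y b) := hev.self_of_nhds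
  have hWy : W y = extChartAt (prodModel m) (ψ p) (ψ p) := chartMap_self hp
  have hW1 : (W y).1 = (ψ p).1 := by rw [chartMap_fst, hsymmy]
  have hW2 : (W y).2 = extChartAt (𝓡 m) (ψ p).2 (ψ p).2 := by rw [chartMap_snd, hsymmy]
  have htgt : (W y).2 ∈ (extChartAt (𝓡 m) (ψ p).2).target := by
    rw [hW2]; exact mem_extChartAt_target (ψ p).2
  let hc : Euc m → ℝ := fun x => D.h ((extChartAt (𝓡 m) (ψ p).2).symm x)
  have hhd : DifferentiableAt ℝ hc (W y).2 := by
    have := D.contMDiff_h.contMDiffAt.comp (W y).2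
      (contMDiffAt_extChartAt_symm_of_mem_target htgt)
    exact (contMDiffAt_iff_contDiffAt.1 this).differentiableAt (by simp)
  have hint : (W y).1 ∈ D.interval := by rw [hW1]; exact hψ.mem_interval p
  have hrd : DifferentiableAt ℝ D.ρ (W y).1 :=
    (D.contDiffOn_ρ.contDiffAt (D.isOpen_interval.mem_nhds hint)).differentiableAt (by simp)
  have hsd : DifferentiableAt ℝ (formInChart D.σ.inner (ψ p).2) (W y).2 :=
    ((contDiffOn_formInChart D.σ.contMDiff (ψ p).2).contDiffAt
      ((isOpen_extChartAt_target (ψ p).2).mem_nhds htgt)).differentiableAt (by simp)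
  have hN := D.isFutureUnitNormal_futureUnitNormal hψ p
  set n : ℝ × Euc m := D.futureUnitNormal ψ p with hndef
  have hself : ∀ u v : ℝ × Euc m, D.chartForm (ψ p) (W y) u v = D.metric (ψ p) u v := by
    intro u v; rw [hWy]; exact D.chartForm_self (ψ p) u v
  have hspan' : ∀ v : Euc m, ∃ w : Euc m,
      @Eq (ℝ × Euc m) (fderiv ℝ W y v) (mfderiv (𝓡 m) (prodModel m) ψ p w) := by
    intro v
    have hinj : Function.Injective (mfderiv 𝓘(ℝ, Euc m) (𝓡 m) (extChartAt (𝓡 m) p₀).symm y) :=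
      (mfderiv_extChartAt_symm_bijective ((extChartAt (𝓡 m) p₀).map_source hp)).1
    let w : Euc m := mfderiv 𝓘(ℝ, Euc m) (𝓡 m) (extChartAt (𝓡 m) p₀).symm y v
    refine ⟨w, ?_⟩
    refine Eq.trans (congrArg (fderiv ℝ W y) ?_)
      (mfderiv_eq_fderiv_chartMap hψ.contMDiff hp w).symm
    exact (hinj (mfderiv_symm_fderiv_transition hp w)).symm
  have hn : ∀ v, D.chartForm (ψ p) (W y) n (fderiv ℝ W y v) = 0 := by
    intro v
    obtain ⟨w, hw⟩ := hspan' v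
    rw [hself]
    exact (D.metric_congr rfl rfl hw).trans (hN.orthogonal w)
  have hnn : D.chartForm (ψ p) (W y) n n = -1 := (hself n n).trans hN.unit
  have hn0 : 0 < n.1 := by
    have h3 := hN.future
    change -(D.h (ψ p).2) ^ 2 * (n.1 * 1) + (D.ρ (ψ p).1) ^ 2 *
      ((show Euc m →L[ℝ] Euc m →L[ℝ] ℝ from D.σ.inner (ψ p).2) n.2 0) < 0 at h3
    have := D.h_pos (ψ p).2
    rw [map_zero] at h3
    by_contra hn
    nlinarith [mul_nonneg (pow_pos this 2).le (neg_nonneg.2 (not_lt.1 hn))]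
  have hpos : ∀ v, v ≠ 0 → 0 < D.chartForm (ψ p) (W y) (fderiv ℝ W y v) (fderiv ℝ W y v) := by
    intro v hv
    obtain ⟨w, hw⟩ := hspan' v
    have hw0 : w ≠ 0 := by
      rintro rfl
      have h0 : fderiv ℝ W y v = 0 := hw.trans (map_zero _)
      refine hv ?_
      rw [ha2 v]
      simp [hGW, h0]
    rw [hself, D.metric_congr rfl hw hw]
    let w' : TangentSpace (𝓡 m) p := w
    have h2 : 0 < inner ℝ w' w' := real_inner_self_pos.2 hw0
    exact h2.trans_eq (hψ.isometric p w w)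
  have hhc : hc (W y).2 = D.h (ψ p).2 := by
    simp only [hc]; rw [hW2, extChartAt_to_inv]
  have hII : ∑ i, (D.chartForm (ψ p) (W y) (fderiv ℝ (fun z => fderiv ℝ W z (a i)) y (a i)) n
        + flatChristoffel (fun x u v => D.chartForm (ψ p) x u v) (W y) (fderiv ℝ W y (a i))
          (fderiv ℝ W y (a i)) n)
      ≤ -(Fintype.card (Fin m) * (deriv D.ρ (W y).1 / (D.ρ (W y).1 * hc (W y).2))) := by
    rw [hhc, hW1, ← Equiv.sum_comp e, Fintype.card_fin]
    have h4 : ∀ i, _ := fun i => D.secondFundamentalForm_eq hψ hp hn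
      (stdOrthonormalBasis ℝ (TangentSpace (𝓡 m) p) i) (a (e i)) (hea i)
    rw [Finset.sum_congr rfl fun i _ => (h4 i).symm]
    -- In dimension `0` the factor `1 / m` is `0`, so clearing it is impossible; both sides are then
    -- `0`.
    rcases Nat.eq_zero_or_pos m with hm | hm
    · have hm0 : (m : ℝ) = 0 := by exact_mod_cast hm
      have : IsEmpty (Fin m) := ⟨fun i => absurd i.isLt (by lia)⟩
      have : IsEmpty (Fin (Module.finrank ℝ (TangentSpace (𝓡 m) p))) := e.isEmpty
      rw [Finset.univ_eq_empty, Finset.sum_empty, hm0, zero_mul, neg_zero]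
    · have hm' : (0 : ℝ) < m := by exact_mod_cast hm
      have h5 := mul_le_mul_of_nonneg_left hH hm'.le
      unfold meanCurvature sliceMeanCurvature at h5
      have h6 : ∀ S : ℝ, (m : ℝ) * -(1 / m * S) = -S := fun S => by field_simp
      rw [h6] at h5
      linarith
  have hmain := warped_time_subsolution (h := hc) (r := D.ρ) (s := formInChart D.σ.inner (ψ p).2)
    (W := W) (y := y) (hW.of_le (by norm_cast)) hhd (D.h_pos _) hrd (D.ρ_pos _ hint)
    (by rw [hW1]; exact hρ) hsd (fun x u v => D.σ.symm _ _ _) hpos hn hnn hn0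
    (fun i => (hGW _ _).symm.trans (ha1 i))
    (fun z => (ha2 z).trans (Finset.sum_congr rfl fun i _ => by rw [hGW]; rfl)) hII
  have hu : (fun x => (W x).1) = fun z => (ψ ((extChartAt (𝓡 m) p₀).symm z)).1 :=
    funext fun z => chartMap_fst _ z
  -- The chart at `ψ p` on the target varies with `p`, but the inequality only sees `h ∘ ψ`, `τ` and
  -- the induced metric, which do not depend on it.
  have hb : (fun x => hc (W x).2) =ᶠ[𝓝 y] fun z => D.h (ψ ((extChartAt (𝓡 m) p₀).symm z)).2 := by
    filter_upwards [eventually_mem_source hψ.contMDiff ((extChartAt (𝓡 m) p₀).map_source hp)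
      (q := ψ p) (by rw [(extChartAt (𝓡 m) p₀).left_inv hp]; exact mem_extChartAt_source (ψ p).2)]
      with z hz
    simp only [hc, W]
    rw [chartMap_snd, (extChartAt (𝓡 m) (ψ p).2).left_inv hz.2]
  have hfl : ∀ u v w, flatChristoffel (fun z v w => formInChart g p₀ z v w) y u v w =
      flatChristoffel (fun x u v => warpedForm hc D.ρ (formInChart D.σ.inner (ψ p).2) (W x)
        (fderiv ℝ W x u) (fderiv ℝ W x v)) y u v w :=
    fun u v w => flatChristoffel_congr hev u v w
  rw [hu, hb.fderiv_eq, hhc, hW1] at hmain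
  simp only [hfl, hsymmy]
  exact hmain

end DoublyWarpedProduct

/-! ### From the Hessian inequality to uniform ellipticity. -/

section UniformBounds

set_option maxSynthPendingDepth 6

variable {E : Type*} [NormedAddCommGroup E] [InnerProductSpace ℝ E] [FiniteDimensional ℝ E]
  {ι : Type*} [Fintype ι]

/-- By compactness of the unit sphere and homogeneity. -/
theorem exists_pos_mul_sq_norm_le (B : E →L[ℝ] E →L[ℝ] ℝ) (hB : ∀ v, v ≠ 0 → 0 < B v v) :
    ∃ c, 0 < c ∧ ∀ v, c * ‖v‖ ^ 2 ≤ B v v := by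
  rcases subsingleton_or_nontrivial E with h | h
  · exact ⟨1, one_pos, fun v => by simp [Subsingleton.elim v 0]⟩
  · obtain ⟨v₀, hv₀, hmin⟩ := (isCompact_sphere (0 : E) 1).exists_isMinOn
      (NormedSpace.sphere_nonempty.2 zero_le_one)
      (show ContinuousOn (fun v => B v v) _ from
        (B.continuous.clm_apply continuous_id).continuousOn)
    have h0 : v₀ ≠ 0 := by rintro rfl; simp at hv₀
    refine ⟨B v₀ v₀, hB v₀ h0, fun v => ?_⟩
    by_cases hv : v = 0
    · simp [hv]
    have hn : 0 < ‖v‖ := norm_pos_iff.2 hv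
    have h1 := isMinOn_iff.1 hmin (‖v‖⁻¹ • v) (by simp [norm_smul, hn.ne'])
    simp only [map_smul, smul_apply, smul_eq_mul] at h1
    have h2 := mul_le_mul_of_nonneg_right h1 (sq_nonneg ‖v‖)
    refine h2.trans_eq ?_
    field_simp

/-- Linear algebra of an orthonormal frame `a` of an inner product `B` dominated by the given
one. -/
theorem sq_norm_le_mul_sum_inner_sq (B : E →L[ℝ] E →L[ℝ] ℝ) {K : ℝ} (hK : ‖B‖ ≤ K) {a : ι → E}
    (ha : ∀ z, z = ∑ i, B z (a i) • a i) (w : E) : ‖w‖ ^ 2 ≤ K * ∑ i, inner ℝ w (a i) ^ 2 := by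
  have h1 : ‖w‖ ^ 2 = ∑ i, B w (a i) * inner ℝ w (a i) := by
    rw [← real_inner_self_eq_norm_sq]
    conv_lhs => rw [ha w]
    nth_rewrite 2 [← ha w]
    rw [sum_inner]
    refine Finset.sum_congr rfl fun i _ => ?_
    rw [real_inner_smul_left, real_inner_comm]
  have h2 : B w w = ∑ i, B w (a i) ^ 2 := by
    conv_lhs => rw [ha w]
    nth_rewrite 1 [← ha w]
    rw [map_sum]
    refine Finset.sum_congr rfl fun i _ => ?_
    rw [map_smul, smul_eq_mul, sq]
  have h3 : B w w ≤ K * ‖w‖ ^ 2 := by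
    refine (le_abs_self _).trans ((B.le_opNorm₂ w w).trans ?_)
    rw [mul_assoc, ← sq]
    gcongr
  -- Cauchy–Schwarz for `‖w‖² = ∑ B(w, aᵢ) ⟨w, aᵢ⟩`; the first factor is `B(w, w) ≤ K ‖w‖²`, and one
  -- `‖w‖²` cancels.
  have h4 : (‖w‖ ^ 2) ^ 2 ≤ (∑ i, B w (a i) ^ 2) * ∑ i, inner ℝ w (a i) ^ 2 := by
    rw [h1]; exact Finset.sum_mul_sq_le_sq_mul_sq _ _ _
  rw [← h2] at h4
  have hS : 0 ≤ ∑ i, inner ℝ w (a i) ^ 2 := Finset.sum_nonneg fun i _ => sq_nonneg _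
  by_cases hw : w = 0
  · rw [hw]; simp
  have hn : 0 < ‖w‖ ^ 2 := by positivity
  have h5 : ‖w‖ ^ 2 * ‖w‖ ^ 2 ≤ ‖w‖ ^ 2 * (K * ∑ i, inner ℝ w (a i) ^ 2) := by
    have := mul_le_mul_of_nonneg_right h3 hS
    nlinarith
  exact le_of_mul_le_mul_left h5 hn

theorem abs_flatChristoffel_le {G : E → E →L[ℝ] E →L[ℝ] ℝ} {y : E} (hG : DifferentiableAt ℝ G y)
    {K : ℝ} (hK : ‖fderiv ℝ G y‖ ≤ K) (v z : E) :
    |flatChristoffel (fun x u v => G x u v) y v v z| ≤ 3 / 2 * K * ‖v‖ ^ 2 * ‖z‖ := by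
  have key : ∀ u v w, |fderiv ℝ G y u v w| ≤ K * ‖u‖ * ‖v‖ * ‖w‖ := fun u v w => by
    refine ((fderiv ℝ G y u).le_opNorm₂ v w).trans ?_
    have := (fderiv ℝ G y).le_of_opNorm_le hK u
    gcongr
  simp only [flatChristoffel, fderiv_bilinear_apply hG]
  have h1 := abs_le.1 (key v v z)
  have h2 := abs_le.1 (key z v v)
  rw [abs_le]
  constructor <;> nlinarith

/-- A Hessian inequality with first order terms, in an orthonormal frame of an inner product
`G y`, bounds the second order part from below by the first derivative. -/
theorem frame_estimates {G : E → E →L[ℝ] E →L[ℝ] ℝ} {u b : E → ℝ} {c : ℝ} {y : E}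
    (hG : DifferentiableAt ℝ G y) {μ K L n : ℝ} (hμ : 0 < μ) (hK0 : 0 < K) (hL : L = 1 + 1 / μ)
    (hn : n = Fintype.card ι) (hcoer : ∀ v, μ * ‖v‖ ^ 2 ≤ G y v v) (hGK : ‖G y‖ ≤ K)
    (hGK' : ‖fderiv ℝ G y‖ ≤ K) (hbK : ‖(2 / b y) • fderiv ℝ b y‖ ≤ K)
    (hcK : |c| * ‖fderiv ℝ u y‖ ≤ K) {a : ι → E} (ha1 : ∀ i, G y (a i) (a i) = 1)
    (ha2 : ∀ z, z = ∑ i, G y z (a i) • a i)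
    (hineq : 0 ≤ ∑ i, (fderiv ℝ (fun z => fderiv ℝ u z (a i)) y (a i)
        - flatChristoffel (fun z v w => G z v w) y (a i) (a i) (∑ j, fderiv ℝ u y (a j) • a j)
        + 2 / b y * fderiv ℝ b y (a i) * fderiv ℝ u y (a i)
        + c * fderiv ℝ u y (a i) ^ 2)) :
    (∀ i, ‖a i‖ ≤ L) ∧ (∀ w, 1 / K * ‖w‖ ^ 2 ≤ ∑ i, inner ℝ w (a i) ^ 2) ∧
      -(n * (3 / 2 * K * L ^ 2 * (n * L ^ 2) + 2 * (K * L ^ 2))) * ‖fderiv ℝ u y‖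
        ≤ ∑ i, fderiv ℝ (fun z => fderiv ℝ u z (a i)) y (a i) := by
  have hL1 : 1 ≤ L := by rw [hL]; exact le_add_of_nonneg_right (by positivity)
  have hL0 : 0 ≤ L := zero_le_one.trans hL1
  have hn0 : 0 ≤ n := by rw [hn]; positivity
  have ha : ∀ i, ‖a i‖ ≤ L := by
    intro i
    have h2 : ‖a i‖ ^ 2 ≤ 1 / μ := by
      rw [le_div_iff₀ hμ]
      have := hcoer (a i)
      rw [ha1 i] at this
      linarith
    nlinarith [norm_nonneg (a i)]
  refine ⟨ha, fun w => ?_, ?_⟩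
  · rw [div_mul_eq_mul_div, one_mul, div_le_iff₀' hK0]
    exact sq_norm_le_mul_sum_inner_sq (G y) hGK ha2 w
  have hD : 0 ≤ ‖fderiv ℝ u y‖ := norm_nonneg _
  have hDu : ∀ i, |fderiv ℝ u y (a i)| ≤ ‖fderiv ℝ u y‖ * L := fun i =>
    ((fderiv ℝ u y).le_opNorm (a i)).trans (mul_le_mul_of_nonneg_left (ha i) hD)
  have hZ : ‖∑ j, fderiv ℝ u y (a j) • a j‖ ≤ n * (‖fderiv ℝ u y‖ * L ^ 2) := by
    refine (norm_sum_le _ _).trans ((Finset.sum_le_card_nsmul _ _ (‖fderiv ℝ u y‖ * L ^ 2)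
      fun j _ => ?_).trans (by rw [nsmul_eq_mul, Finset.card_univ, hn]))
    rw [norm_smul, Real.norm_eq_abs, sq, ← mul_assoc]
    exact mul_le_mul (hDu j) (ha j) (norm_nonneg _) (by positivity)
  have hterm : ∀ i, -flatChristoffel (fun z v w => G z v w) y (a i) (a i)
        (∑ j, fderiv ℝ u y (a j) • a j)
        + 2 / b y * fderiv ℝ b y (a i) * fderiv ℝ u y (a i) + c * fderiv ℝ u y (a i) ^ 2
      ≤ (3 / 2 * K * L ^ 2 * (n * L ^ 2) + 2 * (K * L ^ 2)) * ‖fderiv ℝ u y‖ := by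
    intro i
    have h1 := abs_flatChristoffel_le hG hGK' (a i) (∑ j, fderiv ℝ u y (a j) • a j)
    have h1' : 3 / 2 * K * ‖a i‖ ^ 2 * ‖∑ j, fderiv ℝ u y (a j) • a j‖
        ≤ 3 / 2 * K * L ^ 2 * (n * (‖fderiv ℝ u y‖ * L ^ 2)) :=
      mul_le_mul (mul_le_mul_of_nonneg_left (pow_le_pow_left₀ (norm_nonneg _) (ha i) 2)
        (by positivity)) hZ (norm_nonneg _) (by positivity)
    have h2 : 2 / b y * fderiv ℝ b y (a i) * fderiv ℝ u y (a i)
        ≤ K * L * (‖fderiv ℝ u y‖ * L) := by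
      refine (le_abs_self _).trans ?_
      rw [abs_mul]
      have h3 := ((2 / b y) • fderiv ℝ b y).le_opNorm (a i)
      rw [smul_apply, smul_eq_mul, Real.norm_eq_abs] at h3
      refine mul_le_mul (h3.trans ?_) (hDu i) (abs_nonneg _) (by positivity)
      exact mul_le_mul hbK (ha i) (norm_nonneg _) hK0.le
    -- The quadratic term counts as linear: one factor of the gradient is absorbed into the bound on
    -- `|c| ‖Du‖`.
    have h4 : c * fderiv ℝ u y (a i) ^ 2 ≤ K * L ^ 2 * ‖fderiv ℝ u y‖ := by
      have h5 : fderiv ℝ u y (a i) ^ 2 ≤ (‖fderiv ℝ u y‖ * L) ^ 2 :=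
        sq_le_sq' (abs_le.1 (hDu i)).1 (abs_le.1 (hDu i)).2
      calc c * fderiv ℝ u y (a i) ^ 2 ≤ |c| * (‖fderiv ℝ u y‖ * L) ^ 2 :=
            mul_le_mul (le_abs_self _) h5 (sq_nonneg _) (abs_nonneg _)
        _ = |c| * ‖fderiv ℝ u y‖ * (L ^ 2 * ‖fderiv ℝ u y‖) := by ring
        _ ≤ K * (L ^ 2 * ‖fderiv ℝ u y‖) := mul_le_mul_of_nonneg_right hcK (by positivity)
        _ = _ := by ring
    have h6 := (abs_le.1 h1).1
    linarith
  have hsum := Finset.sum_le_sum fun i (_ : i ∈ Finset.univ) => hterm i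
  rw [Finset.sum_const, Finset.card_univ, nsmul_eq_mul, ← hn] at hsum
  have hsplit : ∑ i, (fderiv ℝ (fun z => fderiv ℝ u z (a i)) y (a i)
        - flatChristoffel (fun z v w => G z v w) y (a i) (a i) (∑ j, fderiv ℝ u y (a j) • a j)
        + 2 / b y * fderiv ℝ b y (a i) * fderiv ℝ u y (a i)
        + c * fderiv ℝ u y (a i) ^ 2) =
      ∑ i, fderiv ℝ (fun z => fderiv ℝ u z (a i)) y (a i) +
      ∑ i, (-flatChristoffel (fun z v w => G z v w) y (a i) (a i)
        (∑ j, fderiv ℝ u y (a j) • a j)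
        + 2 / b y * fderiv ℝ b y (a i) * fderiv ℝ u y (a i)
        + c * fderiv ℝ u y (a i) ^ 2) := by
    rw [← Finset.sum_add_distrib]
    exact Finset.sum_congr rfl fun i _ => by ring
  rw [hsplit] at hineq
  linarith

theorem continuousAt_fderiv_of_contDiffOn {F : Type*} [NormedAddCommGroup F] [NormedSpace ℝ F]
    {f : E → F} {V : Set E} (hV : IsOpen V) (hf : ContDiffOn ℝ 1 f V) {y : E} (hy : y ∈ V) :
    ContinuousAt (fderiv ℝ f) y :=
  (hf.continuousOn_fderiv_of_isOpen hV le_rfl).continuousAt (hV.mem_nhds hy)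

/-- A Hessian inequality with first order terms with continuous coefficients, in orthonormal frames
of a Riemannian metric `G`, gives a uniformly elliptic differential inequality locally. -/
theorem exists_isEllipticSubsolutionOn {G : E → E →L[ℝ] E →L[ℝ] ℝ} {u b c : E → ℝ} {V : Set E}
    (hV : IsOpen V) {y₀ : E} (hy₀ : y₀ ∈ V) (hG : ContDiffOn ℝ 1 G V)
    (hpos : ∀ v, v ≠ 0 → 0 < G y₀ v v) (hu : ContDiffOn ℝ 1 u V) (hb : ContDiffOn ℝ 1 b V)
    (hb0 : b y₀ ≠ 0) (hc : ContinuousAt c y₀)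
    (hsub : ∀ y ∈ V, ∃ a : ι → E, (∀ i, G y (a i) (a i) = 1) ∧ (∀ z, z = ∑ i, G y z (a i) • a i) ∧
      0 ≤ ∑ i, (fderiv ℝ (fun z => fderiv ℝ u z (a i)) y (a i)
        - flatChristoffel (fun z v w => G z v w) y (a i) (a i) (∑ j, fderiv ℝ u y (a j) • a j)
        + 2 / b y * fderiv ℝ b y (a i) * fderiv ℝ u y (a i)
        + c y * fderiv ℝ u y (a i) ^ 2)) :
    ∃ U ⊆ V, IsOpen U ∧ y₀ ∈ U ∧ ∃ lam Lam C, 0 < lam ∧ 0 ≤ C ∧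
      IsEllipticSubsolutionOn ι u U lam Lam C := by
  have hGc : ContinuousAt G y₀ := hG.continuousOn.continuousAt (hV.mem_nhds hy₀)
  have hbc : ContinuousAt b y₀ := hb.continuousOn.continuousAt (hV.mem_nhds hy₀)
  have hG' := continuousAt_fderiv_of_contDiffOn hV hG hy₀
  have hb' := continuousAt_fderiv_of_contDiffOn hV hb hy₀
  have hu' := continuousAt_fderiv_of_contDiffOn hV hu hy₀
  obtain ⟨μ, hμ, hcoer⟩ := exists_pos_mul_sq_norm_le (G y₀) hpos
  have hbd : ∀ {f : E → ℝ}, ContinuousAt f y₀ → ∀ᶠ K in atTop, ∀ᶠ y in 𝓝 y₀, f y < K :=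
    fun {f} hf => (eventually_gt_atTop (f y₀)).mono fun K hK => hf.eventually_lt_const hK
  -- One constant bounds every coefficient near `y₀`. Coercivity of `G y₀` with constant `μ`
  -- survives nearby with `μ / 2`, since `‖G y - G y₀‖ < μ / 2`.
  obtain ⟨K, hK0, hK1, hK2, hK3, hK4⟩ := ((eventually_gt_atTop 0).and ((hbd hGc.norm).and
    ((hbd hG'.norm).and ((hbd ((continuousAt_const (y := (2 : ℝ))).div hbc hb0 |>.smul hb').norm).and
      (hbd (hc.abs.mul hu'.norm)))))).exists
  have hev : ∀ᶠ y in 𝓝 y₀, ‖G y - G y₀‖ < μ / 2 :=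
    ((hGc.sub continuousAt_const).norm).eventually_lt_const (by simpa using hμ)
  obtain ⟨U, hUs, hUo, hyU⟩ := eventually_nhds_iff.1
    ((hV.eventually_mem hy₀).and (hev.and (hK1.and (hK2.and (hK3.and hK4)))))
  refine ⟨U, fun y hy => (hUs y hy).1, hUo, hyU, 1 / K, 1 + 1 / (μ / 2),
    Fintype.card ι * (3 / 2 * K * (1 + 1 / (μ / 2)) ^ 2 * (Fintype.card ι * (1 + 1 / (μ / 2)) ^ 2)
      + 2 * (K * (1 + 1 / (μ / 2)) ^ 2)), by positivity, by positivity, fun y hy => ?_⟩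
  obtain ⟨hyV, hyμ, h1, h2, h3, h4⟩ := hUs y hy
  obtain ⟨a, ha1, ha2, hineq⟩ := hsub y hyV
  refine ⟨a, frame_estimates ((hG.contDiffAt (hV.mem_nhds hyV)).differentiableAt
    (by simp)) (half_pos hμ) hK0 rfl rfl (fun v => ?_) h1.le h2.le h3.le h4.le ha1 ha2 hineq⟩
  have h2 := (abs_le.1 ((G y - G y₀).le_opNorm₂ v v)).1
  have h3 : ‖G y - G y₀‖ * ‖v‖ * ‖v‖ ≤ μ / 2 * ‖v‖ * ‖v‖ := by gcongr
  simp only [sub_apply] at h2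
  have h4 := hcoer v
  nlinarith

end UniformBounds

/-! ### The maximum principle for the time function and the conclusion. -/

namespace DoublyWarpedProduct

variable {m : ℕ} {P : Type*} [TopologicalSpace P] [ChartedSpace (Euc m) P]
  [IsManifold (𝓡 m) ∞ P] (D : DoublyWarpedProduct m P)
  {M : Type*} [TopologicalSpace M] [ChartedSpace (Euc m) M] [IsManifold (𝓡 m) ∞ M]
  [RiemannianBundle (fun p : M => TangentSpace (𝓡 m) p)] {ψ : M → ℝ × P}

theorem formInChart_pos {g : ∀ x : M, TangentSpace (𝓡 m) x →L[ℝ] TangentSpace (𝓡 m) x →L[ℝ] ℝ}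
    (hg : ∀ (x : M) (v w : TangentSpace (𝓡 m) x), inner ℝ v w = g x v w) {p₀ : M} {y : Euc m}
    (hy : y ∈ (extChartAt (𝓡 m) p₀).target) {v : Euc m} (hv : v ≠ 0) :
    0 < formInChart g p₀ y v v := by
  let w : TangentSpace (𝓡 m) ((extChartAt (𝓡 m) p₀).symm y) :=
    mfderiv 𝓘(ℝ, Euc m) (𝓡 m) (extChartAt (𝓡 m) p₀).symm y v
  have hw : w ≠ 0 := fun h => hv ((mfderiv_extChartAt_symm_eq_zero_iff hy v).1 h)
  have h1 : 0 < inner ℝ w w := real_inner_self_pos.2 hw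
  exact h1.trans_eq (hg _ w w)

/-- The strong maximum principle for the time function of a hypersurface whose mean curvature is at
least that of the slices. -/
theorem eventually_fst_eq_of_isMax
    [IsContMDiffRiemannianBundle (𝓡 m) ∞ (Euc m) (fun p : M => TangentSpace (𝓡 m) p)]
    (hρ : ∀ t ∈ D.interval, 0 ≤ deriv D.ρ t) (hψ : D.IsSpacelikeImmersion ψ)
    (hH : ∀ p, D.sliceMeanCurvature (ψ p) ≤ D.meanCurvature ψ p) {p₀ : M}
    (hmax : ∀ p, (ψ p).1 ≤ (ψ p₀).1) : ∀ᶠ p in 𝓝 p₀, (ψ p).1 = (ψ p₀).1 := by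
  obtain ⟨g, hgs, hg⟩ := IsContMDiffRiemannianBundle.exists_contMDiff (IB := 𝓡 m) (n := ∞)
    (F := Euc m) (E := fun p : M => TangentSpace (𝓡 m) p)
  have hy₀ : extChartAt (𝓡 m) p₀ p₀ ∈ (extChartAt (𝓡 m) p₀).target := mem_extChartAt_target p₀
  have hV : IsOpen (extChartAt (𝓡 m) p₀).target := isOpen_extChartAt_target p₀
  have hinv : (extChartAt (𝓡 m) p₀).symm (extChartAt (𝓡 m) p₀ p₀) = p₀ := extChartAt_to_inv p₀
  have hcomp : ContMDiffOn 𝓘(ℝ, Euc m) (prodModel m) ∞ (fun z => ψ ((extChartAt (𝓡 m) p₀).symm z))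
      (extChartAt (𝓡 m) p₀).target :=
    hψ.contMDiff.comp_contMDiffOn (contMDiffOn_extChartAt_symm p₀)
  have hu : ContDiffOn ℝ ∞ (fun z => (ψ ((extChartAt (𝓡 m) p₀).symm z)).1)
      (extChartAt (𝓡 m) p₀).target :=
    contMDiffOn_iff_contDiffOn.1 (contMDiff_fst.comp_contMDiffOn hcomp)
  have hb : ContDiffOn ℝ ∞ (fun z => D.h (ψ ((extChartAt (𝓡 m) p₀).symm z)).2)
      (extChartAt (𝓡 m) p₀).target :=
    contMDiffOn_iff_contDiffOn.1
      ((D.contMDiff_h.comp contMDiff_snd).comp_contMDiffOn hcomp)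
  have hint := hψ.mem_interval p₀
  have hcρ : ContinuousAt (fun t => deriv D.ρ t / D.ρ t) (ψ p₀).1 := by
    refine ContinuousAt.div ?_ ?_ (D.ρ_pos _ hint).ne'
    · exact (D.contDiffOn_ρ.continuousOn_deriv_of_isOpen D.isOpen_interval
        (by simp)).continuousAt (D.isOpen_interval.mem_nhds hint)
    · exact D.contDiffOn_ρ.continuousOn.continuousAt (D.isOpen_interval.mem_nhds hint)
  have hc : ContinuousAt (fun z => deriv D.ρ (ψ ((extChartAt (𝓡 m) p₀).symm z)).1 /
      D.ρ (ψ ((extChartAt (𝓡 m) p₀).symm z)).1) (extChartAt (𝓡 m) p₀ p₀) :=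
    ContinuousAt.comp (g := fun t => deriv D.ρ t / D.ρ t)
      (f := fun z => (ψ ((extChartAt (𝓡 m) p₀).symm z)).1) (by rwa [hinv])
      (hu.continuousOn.continuousAt (hV.mem_nhds hy₀))
  obtain ⟨U, hUV, hUo, hyU, lam, Lam, C, hlam, hC, hell⟩ :=
    exists_isEllipticSubsolutionOn (ι := Fin m) hV hy₀
      ((contDiffOn_formInChart hgs p₀).of_le (by norm_cast))
      (fun v hv => formInChart_pos hg hy₀ hv) (hu.of_le (by norm_cast)) (hb.of_le (by norm_cast))
      (D.h_pos _).ne' hc (fun y hy => by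
        have hp : (extChartAt (𝓡 m) p₀).symm y ∈ (extChartAt (𝓡 m) p₀).source :=
          (extChartAt (𝓡 m) p₀).map_target hy
        have h1 := D.exists_isTimeSubsolutionAt hg hψ hp (hρ _ (hψ.mem_interval _)) (hH _)
        rw [(extChartAt (𝓡 m) p₀).right_inv hy] at h1
        exact h1)
  have hconst := hell.eventually_eq_of_isMax hUo ((hu.mono hUV).of_le (by norm_cast)) hlam hC hyU
    (fun y _ => by rw [hinv]; exact hmax _)
  rw [hinv] at hconst
  filter_upwards [(continuousAt_extChartAt (I := 𝓡 m) p₀).eventually hconst,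
    (isOpen_extChartAt_source p₀).mem_nhds (mem_extChartAt_source (I := 𝓡 m) p₀)] with p h1 h2
  rwa [(extChartAt (𝓡 m) p₀).left_inv h2] at h1

/-- A complete spacelike immersion with constant time function covers a slice. -/
theorem range_eq_slice_of_fst_const [T2Space P] [ConnectedSpace P]
    {M : Type*} [EMetricSpace M] [Nonempty M] [ChartedSpace (Euc m) M] [IsManifold (𝓡 m) ∞ M]
    [RiemannianBundle (fun p : M => TangentSpace (𝓡 m) p)]
    [IsContMDiffRiemannianBundle (𝓡 m) ∞ (Euc m) (fun p : M => TangentSpace (𝓡 m) p)]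
    [IsRiemannianManifold (𝓡 m) M] [CompleteSpace M]
    {ψ : M → ℝ × P} (hψ : D.IsSpacelikeImmersion ψ) {t₀ : ℝ} (ht : ∀ p, (ψ p).1 = t₀) :
    range ψ = D.slice t₀ := by
  have hφ : ContMDiff (𝓡 m) (𝓡 m) ∞ (fun p => (ψ p).2) := contMDiff_snd.comp hψ.contMDiff
  have hd : ∀ (p : M) (v : Euc m), @Eq (ℝ × Euc m) (mfderiv (𝓡 m) (prodModel m) ψ p v)
      (0, mfderiv (𝓡 m) (𝓡 m) (fun p => (ψ p).2) p v) := by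
    intro p v
    have h0 : ψ = fun p => (t₀, (ψ p).2) := funext fun p => Prod.ext (ht p) rfl
    have h5 := mfderiv_prodMk (I := 𝓡 m) (I' := 𝓘(ℝ, ℝ)) (I'' := 𝓡 m) (x := p)
      (f := fun _ : M => t₀) (g := fun p => (ψ p).2) mdifferentiableAt_const
      (hφ.mdifferentiable (by simp) p)
    have h6 : @Eq (Euc m →L[ℝ] ℝ × Euc m) (mfderiv (𝓡 m) (prodModel m) ψ p)
        (mfderiv (𝓡 m) (prodModel m) (fun p => (t₀, (ψ p).2)) p) := by
      rw [← h0]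
    refine (congrArg (fun L : Euc m →L[ℝ] ℝ × Euc m => L v) (h6.trans h5)).trans ?_
    refine Prod.ext ?_ rfl
    change mfderiv (𝓡 m) 𝓘(ℝ, ℝ) (fun _ : M => t₀) p v = 0
    rw [mfderiv_const]; rfl
  -- With constant time, `dψ` has no `∂_t` component, and the induced metric is `ρ(t₀)²` times the
  -- pullback of `σ`.
  have hsurj := surjective_of_homothety D.σ (k := D.ρ t₀ ^ 2) hφ (sq_nonneg _) (fun p v => by
    refine (hψ.isometric p v v).trans ((D.metric_congr rfl (hd p v) (hd p v)).trans ?_)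
    change -(D.h (ψ p).2) ^ 2 * ((0 : ℝ) * 0) + D.ρ (ψ p).1 ^ 2 * _ = _
    rw [mul_zero, mul_zero, zero_add, ht p])
  ext ⟨t, x⟩
  constructor
  · rintro ⟨p, hp⟩
    exact ⟨by rw [← ht p, hp]; rfl, mem_univ _⟩
  · rintro ⟨h1, -⟩
    obtain ⟨p, hp⟩ := hsurj x
    exact ⟨p, Prod.ext ((ht p).trans (show t = t₀ from h1).symm) hp⟩

end DoublyWarpedProduct

end

theorem theorem3p8 {m : ℕ}
    {P : Type*} [TopologicalSpace P] [T2Space P] [SecondCountableTopology P] [ConnectedSpace P]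
    [ChartedSpace (Euc m) P] [IsManifold (𝓡 m) ∞ P]
    (D : DoublyWarpedProduct m P)
    (hρ : ∀ t ∈ D.interval, 0 ≤ deriv D.ρ t)
    {M : Type*} [EMetricSpace M] [SecondCountableTopology M] [ConnectedSpace M]
    [NoncompactSpace M] [ChartedSpace (Euc m) M] [IsManifold (𝓡 m) ∞ M]
    [RiemannianBundle (fun p : M => TangentSpace (𝓡 m) p)]
    [IsContMDiffRiemannianBundle (𝓡 m) ∞ (Euc m) (fun p : M => TangentSpace (𝓡 m) p)]
    [IsRiemannianManifold (𝓡 m) M] [CompleteSpace M]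
    (ψ : M → ℝ × P) (hψ : D.IsSpacelikeImmersion ψ)
    (t₀ : ℝ) (ht₀ : t₀ ∈ D.interval)
    (habove : ∀ p, t₀ ≤ (ψ p).1)
    (hasymp : Tendsto (fun p => (ψ p).1) (cocompact M) (𝓝 t₀))
    (hH : ∀ p, D.sliceMeanCurvature (ψ p) ≤ D.meanCurvature ψ p) :
    range ψ = D.slice t₀ := by
  refine D.range_eq_slice_of_fst_const hψ fun p₁ => ?_
  by_contra hne
  have hlt : t₀ < (ψ p₁).1 := lt_of_le_of_ne (habove p₁) (Ne.symm hne)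
  have hτ : Continuous fun p => (ψ p).1 := continuous_fst.comp hψ.contMDiff.continuous
  -- Outside a compact set `τ` stays below its value at `p₁`, so the maximum is attained.
  obtain ⟨p₀, hp₀⟩ := hτ.exists_forall_ge' p₁
    ((hasymp.eventually_lt_const hlt).mono fun p hp => hp.le)
  have hclopen : IsClopen {p | (ψ p).1 = (ψ p₀).1} := by
    refine ⟨isClosed_eq hτ continuous_const, isOpen_iff_mem_nhds.2 fun p hp => ?_⟩
    have hp' : (ψ p).1 = (ψ p₀).1 := hp
    have h1 := D.eventually_fst_eq_of_isMax hρ hψ hH (p₀ := p) (fun q => (hp₀ q).trans_eq hp'.symm)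
    rwa [hp'] at h1
  have huniv := hclopen.eq_univ ⟨p₀, rfl⟩
  have hconst : ∀ p, (ψ p).1 = (ψ p₀).1 := fun p => huniv.ge (mem_univ p)
  -- Noncompactness makes `cocompact M` a proper filter, so limits along it are unique and the
  -- constant equals `t₀`.
  have hlim : Tendsto (fun p => (ψ p).1) (cocompact M) (𝓝 (ψ p₀).1) := by
    simp only [hconst]; exact tendsto_const_nhds
  exact (hlt.trans_le (hp₀ p₁)).ne (tendsto_nhds_unique hasymp hlim)
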